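/- Conventions. A gridded permutation is a finite permutation whose plot is divided into four quadrants by one vertical and one horizontal line (the axes, meeting at the origin); two are equal if the permutations agree and corresponding quadrants contain the same points, and $\sigma\le\pi$ means that $\sigma$ embeds in $\pi$ preserving both orders and the quadrants. The box sum $\sigma\boxplus\tau$ is obtained by inserting $\sigma$ at the origin of $\tau$; a set $\mathcal C$ of gridded permutations is box-closed if $\sigma\boxplus\tau\in\mathcal C$ for all $\sigma,\tau\in\mathcal C$, and a non-empty gridded permutation is box-indecomposable if it is not the box sum of two smaller ones. The growth rate is $\mathrm{gr}(\mathcal C)=\lim_{n\to\infty}|\mathcal C_n|^{1/n}$, where $\mathcal C_n$ is the set of members of $\mathcal C$ with $n$ points. A pin sequence is an infinite word $w=w_1w_2\cdots$ over the eight letters $\mathsf a_{\mathsf b}$, where $\mathsf a,\mathsf b\in\{\mathsf l,\mathsf r,\mathsf u,\mathsf d\}$ are perpendicular directions, such that the subscript of $w_{i+1}$ is the direction of $w_i$ for every $i$. It defines an infinite gridded set of points $\pi_w=\{p_1,p_2,\dots\}$: $p_1$ lies in the quadrant determined by the two directions of $w_1$, and, for $i\ge1$, $p_{i+1}$ lies,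 in the direction of $w_{i+1}$, beyond the origin and all of $p_1,\dots,p_i$, while in the direction of $w_i$ it lies strictly between $p_i$ on one side and the origin and all of $p_1,\dots,p_{i-1}$ on the other. The pin class $\mathcal C_w$ is the set of all finite gridded permutations contained in $\pi_w$. For an infinite binary word $s$, $\phi(s)$ is the pin sequence obtained by replacing each $0$ by $\mathsf l_{\mathsf u}\mathsf u_{\mathsf l}$ and each $1$ by $\mathsf r_{\mathsf u}\mathsf u_{\mathsf r}$. An infinite binary word is Sturmian if it has exactly $n+1$ distinct factors of length $n$ for every $n\ge 0$. Theorem. Let $\mu\approx 3.28277$ be the largest real zero of $z^5-4z^4+3z^3-2z^2-z+2$. There are uncountably many distinct pin sequences $w$ with $\mathrm{gr}(\mathcal C_w)=\mu$. More precisely, for every Sturmian word $s$ the pin class $\mathcal C_{\phi(s)}$ has growth rate $\mu$, is box-closed, and its box-indecomposable members, counted by number of points, have generating function $$g_\star(z)=\frac{2z-2z^2+2z^3+z^4-2z^5}{(1-z)^2};$$ moreover, the classes $\mathcal C_{\phi(s)}$, with $s$ Sturmian, form an uncountable set. -/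

import Mathlib

open Filter Topology

/-! ### Permutations gridded by one vertical and one horizontal line -/

/-- A `2 × 2` gridded permutation: a permutation of `{0, …, size - 1}`, the number `vline` of points
to the left of the vertical line, and the number `hline` of points below the horizontal line.  Two
griddings of a permutation are equal exactly when corresponding cells contain the same points. -/
@[ext]
structure GriddedPerm where
  size : ℕ
  perm : Equiv.Perm (Fin size)
  vline : Fin (size + 1)
  hline : Fin (size + 1)

namespace GriddedPerm

/-- The plot of a gridded permutation, drawn with odd coordinates so that the two grid lines are the
coordinate axes. -/
def point (π : GriddedPerm) (i : Fin π.size) : ℤ × ℤ :=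
  (2 * ((i : ℕ) : ℤ) - 2 * ((π.vline : ℕ) : ℤ) + 1,
    2 * ((π.perm i : ℕ) : ℤ) - 2 * ((π.hline : ℕ) : ℤ) + 1)

/-- Containment of a gridded permutation in a (finite or infinite) set of points `q` of the plane
gridded by its axes: an injection of the points preserving the left-to-right order, the
bottom-to-top order, and the quadrants. -/
def ContainedIn {ι : Type*} (π : GriddedPerm) (q : ι → ℤ × ℤ) : Prop :=
  ∃ f : Fin π.size ↪ ι,
    (∀ i j, (π.point i).1 < (π.point j).1 ↔ (q (f i)).1 < (q (f j)).1) ∧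
    (∀ i j, (π.point i).2 < (π.point j).2 ↔ (q (f i)).2 < (q (f j)).2) ∧
    (∀ i, ((π.point i).1 < 0 ↔ (q (f i)).1 < 0) ∧ (0 < (π.point i).1 ↔ 0 < (q (f i)).1)) ∧
    (∀ i, ((π.point i).2 < 0 ↔ (q (f i)).2 < 0) ∧ (0 < (π.point i).2 ↔ 0 < (q (f i)).2))

/-- Open up `n` ordered slots at position `v` and insert a block of `m` new ones there. -/
def insertBlockFun (m n : ℕ) (v : Fin (n + 1)) : Fin m ⊕ Fin n → Fin (m + n)
  | Sum.inl i => ⟨(v : ℕ) + (i : ℕ), by have := v.2; have := i.2; omega⟩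
  | Sum.inr j =>
      ⟨if (j : ℕ) < (v : ℕ) then (j : ℕ) else (j : ℕ) + m, by have := j.2; split_ifs <;> omega⟩

theorem insertBlockFun_bijective (m n : ℕ) (v : Fin (n + 1)) :
    Function.Bijective (insertBlockFun m n v) := by
  rw [Fintype.bijective_iff_injective_and_card]
  refine ⟨?_, by simp⟩
  rintro (i | i) (j | j) h
  all_goals
    have h1 := congrArg Fin.val h
    have := i.2
    have := j.2
    simp only [insertBlockFun] at h1
    first
      | (congr 1; apply Fin.ext; first | omega | (split_ifs at h1 <;> omega))
      | (exfalso; split_ifs at h1 <;> omega)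

/-- `insertBlockFun` as a bijection. -/
noncomputable def insertBlock (m n : ℕ) (v : Fin (n + 1)) : Fin m ⊕ Fin n ≃ Fin (m + n) :=
  Equiv.ofBijective _ (insertBlockFun_bijective m n v)

/-- The box sum `σ ⊞ τ`: a copy of `σ` is inserted at the origin of `τ`. -/
noncomputable def boxSum (σ τ : GriddedPerm) : GriddedPerm where
  size := σ.size + τ.size
  perm := (insertBlock σ.size τ.size τ.vline).symm.trans
    ((Equiv.sumCongr σ.perm τ.perm).trans (insertBlock σ.size τ.size τ.hline))
  vline := ⟨(σ.vline : ℕ) + (τ.vline : ℕ), by have := σ.vline.2; have := τ.vline.2; omega⟩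
  hline := ⟨(σ.hline : ℕ) + (τ.hline : ℕ), by have := σ.hline.2; have := τ.hline.2; omega⟩

/-- A (non-empty) gridded permutation is box indecomposable if it is not the box sum of two smaller
gridded permutations. -/
def IsBoxIndecomposable (π : GriddedPerm) : Prop :=
  0 < π.size ∧ ¬ ∃ σ τ : GriddedPerm, σ.size < π.size ∧ τ.size < π.size ∧ π = σ.boxSum τ

/-- A set of gridded permutations is box closed if it contains the box sum of any two members. -/
def IsBoxClosed (C : Set GriddedPerm) : Prop :=
  ∀ σ ∈ C, ∀ τ ∈ C, σ.boxSum τ ∈ C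

/-- The number of members of `C` of size `n`. -/
noncomputable def count (C : Set GriddedPerm) (n : ℕ) : ℕ :=
  {π : GriddedPerm | π ∈ C ∧ π.size = n}.ncard

/-- `C` has growth rate `r`: the `n`-th roots of its counting sequence converge to `r`. -/
def HasGrowthRate (C : Set GriddedPerm) (r : ℝ) : Prop :=
  Tendsto (fun n : ℕ => (count C n : ℝ) ^ (1 / (n : ℝ))) atTop (𝓝 r)

/-- The generating function of the box indecomposable members of `C`. -/
noncomputable def boxIndecGF (C : Set GriddedPerm) : PowerSeries ℚ :=
  PowerSeries.mk fun n => (count {π | π ∈ C ∧ π.IsBoxIndecomposable} n : ℚ)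

end GriddedPerm

/-! ### Pin sequences and pin classes -/

/-- The four directions: left, right, up, down. -/
inductive PinDir
  | l
  | r
  | u
  | d

namespace PinDir

def isVertical : PinDir → Bool
  | l => false
  | r => false
  | u => true
  | d => true

/-- The unit vector in a direction. -/
def vec : PinDir → ℤ × ℤ
  | l => (-1, 0)
  | r => (1, 0)
  | u => (0, 1)
  | d => (0, -1)

/-- How far a point lies in a given direction. -/
def extent : PinDir → ℤ × ℤ → ℤ
  | l, p => -p.1
  | r, p => p.1
  | u, p => p.2
  | d, p => -p.2

end PinDir

/-- The eight letters of the memory encoding: the direction of a pin together with the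
(perpendicular) direction of the previous pin. -/
structure PinLetter where
  dir : PinDir
  prev : PinDir
  perp : dir.isVertical ≠ prev.isVertical

/-- An infinite word over the memory alphabet is a pin sequence if every letter correctly records
the direction of its predecessor. -/
def IsPinSeq (w : ℕ → PinLetter) : Prop :=
  ∀ i, (w (i + 1)).prev = (w i).dir

/-- The points of the infinite gridded pin permutation `π_w`.  The first point lies in the quadrant
given by its letter.  The lemma `pinPoint_properPin` says that every later point is a pin in the
required direction that separates its predecessor from the origin and all earlier points (these
conditions determine all relative positions). -/
def pinPoint (w : ℕ → PinLetter) (i : ℕ) : ℤ × ℤ :=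
  (2 * (i : ℤ) + 4) • (w i).dir.vec + (2 * (i : ℤ) + 1) • (w i).prev.vec

theorem extent_dir_pinPoint (w : ℕ → PinLetter) (i : ℕ) :
    (w i).dir.extent (pinPoint w i) = 2 * (i : ℤ) + 4 := by
  have h := (w i).perp
  unfold pinPoint
  generalize (w i).dir = a at *
  generalize (w i).prev = b at *
  cases a <;> cases b <;> simp_all [PinDir.extent, PinDir.vec, PinDir.isVertical]

theorem extent_prev_pinPoint (w : ℕ → PinLetter) (i : ℕ) :
    (w i).prev.extent (pinPoint w i) = 2 * (i : ℤ) + 1 := by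
  have h := (w i).perp
  unfold pinPoint
  generalize (w i).dir = a at *
  generalize (w i).prev = b at *
  cases a <;> cases b <;> simp_all [PinDir.extent, PinDir.vec, PinDir.isVertical]

theorem extent_pinPoint_le (w : ℕ → PinLetter) (i : ℕ) (a : PinDir) :
    a.extent (pinPoint w i) ≤ 2 * (i : ℤ) + 4 := by
  have h := (w i).perp
  unfold pinPoint
  generalize (w i).dir = b at *
  generalize (w i).prev = c at *
  cases a <;> cases b <;> cases c <;>
    simp_all [PinDir.extent, PinDir.vec, PinDir.isVertical] <;> omega

/-- Every point of `π_w` after the first is a proper pin: it lies beyond the origin and all earlier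
points in its own direction; and in the direction of its predecessor it lies strictly between
the predecessor on the one side, and the origin and all earlier points on the other. -/
theorem pinPoint_properPin (w : ℕ → PinLetter) (hw : IsPinSeq w) (i : ℕ) :
    (0 < (w (i + 1)).dir.extent (pinPoint w (i + 1)) ∧
      ∀ j ≤ i, (w (i + 1)).dir.extent (pinPoint w j)
        < (w (i + 1)).dir.extent (pinPoint w (i + 1))) ∧
    (0 < (w i).dir.extent (pinPoint w (i + 1)) ∧
      ∀ j < i, (w i).dir.extent (pinPoint w j) < (w i).dir.extent (pinPoint w (i + 1))) ∧
    (w i).dir.extent (pinPoint w (i + 1)) < (w i).dir.extent (pinPoint w i) := by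
  have h1 := extent_dir_pinPoint w (i + 1)
  have h2 := extent_prev_pinPoint w (i + 1)
  have h3 := extent_dir_pinPoint w i
  rw [hw i] at h2
  push_cast at h1 h2
  refine ⟨⟨by omega, fun j hj => ?_⟩, ⟨by omega, fun j hj => ?_⟩, by omega⟩
  · have := extent_pinPoint_le w j (w (i + 1)).dir
    omega
  · have := extent_pinPoint_le w j (w i).dir
    omega

/-- The pin class `C_w`: all finite gridded permutations contained in `π_w`. -/
def pinClass (w : ℕ → PinLetter) : Set GriddedPerm :=
  {σ | σ.ContainedIn (pinPoint w)}

/-! ### Sturmian sequences -/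

/-- The complexity of an infinite binary word: the number of its distinct factors of length `n`. -/
noncomputable def factorComplexity (s : ℕ → Bool) (n : ℕ) : ℕ :=
  {u : Fin n → Bool | ∃ k : ℕ, ∀ i : Fin n, u i = s (k + (i : ℕ))}.ncard

/-- Sturmian sequences: infinite binary words with `n + 1` factors of each length `n`. -/
def IsSturmian (s : ℕ → Bool) : Prop :=
  ∀ n, factorComplexity s n = n + 1

/-- A left (for `false`, that is `0`) or right (for `true`, that is `1`) step. -/
def sideDir : Bool → PinDir
  | false => PinDir.l
  | true => PinDir.r

theorem sideDir_isVertical (b : Bool) : (sideDir b).isVertical = false := by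
  cases b <;> rfl

/-- The map `φ` from binary words to two-quadrant pin sequences, which replaces each `0` by a left
pin followed by an up pin, and each `1` by a right pin followed by an up pin.  (Each left or right
pin follows an up pin; this fixes the memory part of the first letter too.) -/
def pinOfBinary (s : ℕ → Bool) (i : ℕ) : PinLetter :=
  if i % 2 = 0 then
    ⟨sideDir (s (i / 2)), PinDir.u, by rw [sideDir_isVertical]; decide⟩
  else
    ⟨PinDir.u, sideDir (s (i / 2)), by rw [sideDir_isVertical]; decide⟩

/-!
Write `p₀, p₁, …` for the points of `φ(s)`.  All of them lie above the horizontal axis, `pᵢ` being on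
the side of the vertical axis given by the letter `s (i / 2)`, and `pⱼ` lies box-beyond `pᵢ` as soon
as `j ≥ i + 2`.  Everything follows from this picture.

*Free monoid.*  Above the horizontal axis the boxes around the origin that separate a gridded
permutation into two box summands are nested, so the decomposition into box indecomposables is
unique (`boxSum_left_cancel_of_isBoxIndecomposable`).  A Sturmian word is recurrent
(`IsSturmian.exists_ge_forall_eq`), because a tail that misses a factor of length `n` would have at
most `n` factors of that length and so bounded complexity; hence the class is box closed
(`isBoxClosed_pinClass`), and its generating function is `1 / (1 - g)`, where `g` counts the box
indecomposables (`mk_count_mul_one_sub_boxIndecGF`).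

*Box indecomposables.*  A gap in a set of places splits it, so box indecomposables are patterns of
runs of consecutive points; conversely all runs are box indecomposable, except for those of two
points on different sides (`IsRun.isBoxIndecomposable`).  For `n ≥ 4` the pattern of a run of
`n` points determines the parity of its first place (`IsRun.parity_eq`) and the sides of its points
(`IsRun.side_eq`), that is, a factor of `s` of length `⌈n / 2⌉` or `⌊n / 2⌋ + 1`.  A Sturmian word
has `m + 1` factors of length `m`, which gives `n + 3` box indecomposables.  There are coincidences
for `n ≤ 3`, where the numbers are `2, 2, 4`.

*Growth rate.*  The equation `F (1 - g) = 1` is a linear recurrence whose characteristic polynomial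
is the quintic, and `tendsto_root_of_recurrence` reads off the growth rate.

*Uncountability.*  The mechanical words `⌊(n + 1) α⌋ - ⌊n α⌋` with `α` irrational are Sturmian
(`isSturmian_mechanicalWord`).  The class of `φ(s)` determines the long factors of `s`
(`exists_common_factor`), and these determine the slope `α` (`slope_eq_of_common_factors`).
-/

namespace GriddedPerm

/-! ### Maps between gridded point sets -/

section Maps

variable {ι κ ν : Type*}

/-- A map between two indexed sets of points that preserves (and reflects) the left-to-right order,
the bottom-to-top order, and the quadrants. -/
def IsGridMap (p : ι → ℤ × ℤ) (q : κ → ℤ × ℤ) (f : ι → κ) : Prop :=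
  (∀ i j, (p i).1 < (p j).1 ↔ (q (f i)).1 < (q (f j)).1) ∧
  (∀ i j, (p i).2 < (p j).2 ↔ (q (f i)).2 < (q (f j)).2) ∧
  (∀ i, ((p i).1 < 0 ↔ (q (f i)).1 < 0) ∧ (0 < (p i).1 ↔ 0 < (q (f i)).1)) ∧
  (∀ i, ((p i).2 < 0 ↔ (q (f i)).2 < 0) ∧ (0 < (p i).2 ↔ 0 < (q (f i)).2))

theorem IsGridMap.comp {p : ι → ℤ × ℤ} {q : κ → ℤ × ℤ} {r : ν → ℤ × ℤ} {g : κ → ν} {f : ι → κ}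
    (hg : IsGridMap q r g) (hf : IsGridMap p q f) : IsGridMap p r (g ∘ f) :=
  ⟨fun i j => (hf.1 i j).trans (hg.1 _ _), fun i j => (hf.2.1 i j).trans (hg.2.1 _ _),
    fun i => ⟨(hf.2.2.1 i).1.trans (hg.2.2.1 _).1, (hf.2.2.1 i).2.trans (hg.2.2.1 _).2⟩,
    fun i => ⟨(hf.2.2.2 i).1.trans (hg.2.2.2 _).1, (hf.2.2.2 i).2.trans (hg.2.2.2 _).2⟩⟩

theorem isGridMap_comp_right (q : κ → ℤ × ℤ) (f : ι → κ) : IsGridMap (q ∘ f) q f :=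
  ⟨fun _ _ => Iff.rfl, fun _ _ => Iff.rfl, fun _ => ⟨Iff.rfl, Iff.rfl⟩, fun _ => ⟨Iff.rfl, Iff.rfl⟩⟩

/-- A map through which a grid map factors along a grid map is a grid map. -/
theorem IsGridMap.of_comp {p : ι → ℤ × ℤ} {q : κ → ℤ × ℤ} {r : ν → ℤ × ℤ} {g : κ → ν} {f : ι → κ}
    {h : ι → ν} (hg : IsGridMap q r g) (hh : IsGridMap p r h) (e : ∀ i, g (f i) = h i) :
    IsGridMap p q f := by
  refine ⟨fun i j => ?_, fun i j => ?_, fun i => ⟨?_, ?_⟩, fun i => ⟨?_, ?_⟩⟩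
  · rw [hh.1, hg.1, e, e]
  · rw [hh.2.1, hg.2.1, e, e]
  · rw [(hh.2.2.1 i).1, (hg.2.2.1 _).1, e]
  · rw [(hh.2.2.1 i).2, (hg.2.2.1 _).2, e]
  · rw [(hh.2.2.2 i).1, (hg.2.2.2 _).1, e]
  · rw [(hh.2.2.2 i).2, (hg.2.2.2 _).2, e]

theorem IsGridMap.injective {p : ι → ℤ × ℤ} {q : κ → ℤ × ℤ} {f : ι → κ}
    (hf : IsGridMap p q f) (hp : Function.Injective fun i => (p i).1) : Function.Injective f := by
  intro i j hij
  by_contra hne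
  have h1 : (p i).1 ≠ (p j).1 := fun h => hne (hp h)
  rcases lt_or_gt_of_ne h1 with h | h
  · have := (hf.1 _ _).1 h
    rw [hij] at this
    exact lt_irrefl _ this
  · have := (hf.1 _ _).1 h
    rw [hij] at this
    exact lt_irrefl _ this

/-- The point `q` lies beyond the origin and the point `p`, in both of the directions given by the
quadrant of `q`. -/
def IsBeyond (p q : ℤ × ℤ) : Prop :=
  (0 < q.1 → p.1 < q.1) ∧ (q.1 < 0 → q.1 < p.1) ∧ (0 < q.2 → p.2 < q.2) ∧ (q.2 < 0 → q.2 < p.2)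

theorem IsGridMap.isBeyond_iff {p : ι → ℤ × ℤ} {q : κ → ℤ × ℤ} {f : ι → κ}
    (hf : IsGridMap p q f) (i j : ι) : IsBeyond (p i) (p j) ↔ IsBeyond (q (f i)) (q (f j)) := by
  unfold IsBeyond
  rw [hf.1 i j, hf.1 j i, hf.2.1 i j, hf.2.1 j i, (hf.2.2.1 j).1, (hf.2.2.1 j).2, (hf.2.2.2 j).1,
    (hf.2.2.2 j).2]

end Maps

/-! ### Gridded permutations as patterns of point sets -/

section Patterns

variable {ι κ : Type*}

theorem point_fst_lt (π : GriddedPerm) (i j : Fin π.size) :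
    (π.point i).1 < (π.point j).1 ↔ i < j := by
  simp only [point, Fin.lt_def]; omega

theorem point_snd_lt (π : GriddedPerm) (i j : Fin π.size) :
    (π.point i).2 < (π.point j).2 ↔ π.perm i < π.perm j := by
  simp only [point, Fin.lt_def]; omega

theorem point_fst_neg (π : GriddedPerm) (i : Fin π.size) :
    (π.point i).1 < 0 ↔ (i : ℕ) < π.vline := by
  simp only [point]; omega

theorem point_snd_neg (π : GriddedPerm) (i : Fin π.size) :
    (π.point i).2 < 0 ↔ (π.perm i : ℕ) < π.hline := by
  simp only [point]; omega

theorem point_fst_ne_zero (π : GriddedPerm) (i : Fin π.size) : (π.point i).1 ≠ 0 := by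
  simp only [point]; omega

theorem point_snd_ne_zero (π : GriddedPerm) (i : Fin π.size) : (π.point i).2 ≠ 0 := by
  simp only [point]; omega

theorem point_fst_injective (π : GriddedPerm) : Function.Injective fun i => (π.point i).1 := by
  intro i j h
  simp only [point] at h
  apply Fin.ext
  omega

theorem point_snd_injective (π : GriddedPerm) : Function.Injective fun i => (π.point i).2 := by
  intro i j h
  simp only [point] at h
  apply π.perm.injective
  apply Fin.ext
  omega

theorem containedIn_iff (π : GriddedPerm) (q : ι → ℤ × ℤ) :
    π.ContainedIn q ↔ ∃ f, IsGridMap π.point q f :=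
  ⟨fun ⟨f, hf⟩ => ⟨f, hf⟩, fun ⟨f, hf⟩ => ⟨⟨f, hf.injective π.point_fst_injective⟩, hf⟩⟩

theorem eq_id_of_strictMono_of_surjective {n : ℕ} {f : Fin n → Fin n} (hf : StrictMono f)
    (hs : Function.Surjective f) : f = id := by
  rw [← hf.range_inj strictMono_id, hs.range_eq, Set.range_id]

/-- A gridded permutation is determined by the orders and quadrants of its points. -/
theorem eq_of_isGridMap {π π' : GriddedPerm} {f : Fin π.size → Fin π'.size}
    (hf : IsGridMap π.point π'.point f) (hs : Function.Surjective f) : π = π' := by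
  have hinj := hf.injective π.point_fst_injective
  have hcard : π.size = π'.size := by
    simpa using Fintype.card_of_bijective ⟨hinj, hs⟩
  obtain ⟨h1, h2, h3, h4⟩ := hf
  simp only [point_fst_lt, point_snd_lt, point_fst_neg, point_snd_neg] at h1 h2 h3 h4
  obtain ⟨n, p, v, h⟩ := π
  obtain ⟨n', p', v', h'⟩ := π'
  obtain rfl : n = n' := hcard
  have hid : f = id := eq_id_of_strictMono_of_surjective (fun i j hij => (h1 i j).1 hij) hs
  subst hid
  have hp : p = p' := by
    have : (fun i => p' (p.symm i)) = id := by
      apply eq_id_of_strictMono_of_surjective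
      · intro i j hij
        have := (h2 (p.symm i) (p.symm j))
        simp only [Equiv.apply_symm_apply, id] at this
        exact this.1 hij
      · exact (p'.surjective.comp p.symm.surjective)
    ext i
    have := congrFun this (p i)
    simp at this
    rw [this]
  subst hp
  have key : ∀ (a b : Fin (n + 1)), (∀ i : Fin n, (i : ℕ) < a ↔ (i : ℕ) < b) → a = b := by
    intro a b hab
    apply Fin.ext
    have ha := a.2
    have hb := b.2
    by_contra hne
    rcases lt_or_gt_of_ne hne with hlt | hlt
    · have := (hab ⟨a, by omega⟩).2 hlt
      simp at this
    · have := (hab ⟨b, by omega⟩).1 hlt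
      simp at this
  congr 1
  · exact key _ _ fun i => (h3 i).1
  · refine key _ _ fun i => ?_
    have := (h4 (p.symm i)).1
    simpa using this

/-- Two gridded permutations that map onto the same points of a set are equal. -/
theorem eq_of_range_eq {π π' : GriddedPerm} {q : ι → ℤ × ℤ} {f : Fin π.size → ι}
    {g : Fin π'.size → ι} (hf : IsGridMap π.point q f) (hg : IsGridMap π'.point q g)
    (h : Set.range f = Set.range g) : π = π' := by
  have hex : ∀ i, ∃ j, g j = f i := fun i => by
    have : f i ∈ Set.range g := h ▸ Set.mem_range_self i
    exact this
  choose e he using hex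
  refine eq_of_isGridMap (f := e) (hg.of_comp hf he) fun j => ?_
  have : g j ∈ Set.range f := h ▸ Set.mem_range_self j
  obtain ⟨i, hi⟩ := this
  exact ⟨i, hg.injective π'.point_fst_injective ((he i).trans hi)⟩

theorem exists_fin_forall_iff_lt {n : ℕ} (P : Fin n → Prop) (hP : ∀ i j, i ≤ j → P j → P i) :
    ∃ v : Fin (n + 1), ∀ i, P i ↔ (i : ℕ) < v := by
  classical
  have hex : ∃ v, ∀ i, P i → (i : ℕ) < v := ⟨n, fun i _ => i.2⟩
  refine ⟨⟨Nat.find hex, Nat.lt_succ_of_le (Nat.find_min' hex fun i _ => i.2)⟩, fun i =>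
    ⟨Nat.find_spec hex i, fun hi => ?_⟩⟩
  by_contra hPi
  refine Nat.find_min hex hi fun j hj => ?_
  by_contra hlt
  exact hPi (hP i j (by rw [Fin.le_def]; omega) hj)

/-- Every finite set of points off the axes, with distinct abscissas and distinct ordinates, has
a gridded permutation as its pattern. -/
theorem exists_isGridMap_bijective [Fintype ι] (q : ι → ℤ × ℤ)
    (hx : Function.Injective fun i => (q i).1) (hy : Function.Injective fun i => (q i).2)
    (hx0 : ∀ i, (q i).1 ≠ 0) (hy0 : ∀ i, (q i).2 ≠ 0) :
    ∃ (π : GriddedPerm) (f : Fin π.size → ι), IsGridMap π.point q f ∧ Function.Bijective f := by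
  have hrank : ∀ c : ι → ℤ, Function.Injective c →
      ∃ e : ι ≃ Fin (Fintype.card ι), ∀ i j, e i < e j ↔ c i < c j := by
    intro c hc
    let _ : LinearOrder ι := LinearOrder.lift' c hc
    let e := (Fintype.orderIsoFinOfCardEq ι rfl).symm
    exact ⟨e.toEquiv, fun i j => e.lt_iff_lt⟩
  obtain ⟨ex, hex⟩ := hrank _ hx
  obtain ⟨ey, hey⟩ := hrank _ hy
  have hline : ∀ (c : ι → ℤ) (e : ι ≃ Fin (Fintype.card ι)), (∀ i j, e i < e j ↔ c i < c j) →
      ∃ v : Fin (Fintype.card ι + 1), ∀ i, c i < 0 ↔ (e i : ℕ) < v := by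
    intro c e he
    obtain ⟨v, hv⟩ := exists_fin_forall_iff_lt (fun i => c (e.symm i) < 0) (fun i j hij hj => by
      have := (he (e.symm j) (e.symm i)).not
      simp only [Equiv.apply_symm_apply, not_lt] at this
      exact lt_of_le_of_lt (this.1 hij) hj)
    exact ⟨v, fun i => by simpa using hv (e i)⟩
  obtain ⟨v, hv⟩ := hline _ ex hex
  obtain ⟨h, hh⟩ := hline _ ey hey
  let π : GriddedPerm := ⟨Fintype.card ι, ex.symm.trans ey, v, h⟩
  refine ⟨π, ex.symm, ⟨fun i j => ?_, fun i j => ?_, fun i => ?_, fun i => ?_⟩, ex.symm.bijective⟩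
  · rw [point_fst_lt, ← hex]; simp
  · rw [point_snd_lt, ← hey]; simp [π]
  · have h1 : (π.point i).1 < 0 ↔ (q (ex.symm i)).1 < 0 := by
      rw [point_fst_neg, hv]; simp [π]
    have h2 := point_fst_ne_zero π i
    have h3 := hx0 (ex.symm i)
    exact ⟨h1, by omega⟩
  · have h1 : (π.point i).2 < 0 ↔ (q (ex.symm i)).2 < 0 := by
      rw [point_snd_neg, hh]; simp [π]
    have h2 := point_snd_ne_zero π i
    have h3 := hy0 (ex.symm i)
    exact ⟨h1, by omega⟩

end Patterns

/-! ### Box sums and cuts -/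

section BoxSum

variable {ι : Type*} (σ τ : GriddedPerm)

/-- The copy of `σ` in `σ ⊞ τ`. -/
noncomputable def boxInl (i : Fin σ.size) : Fin (σ.boxSum τ).size :=
  insertBlock σ.size τ.size τ.vline (Sum.inl i)

/-- The copy of `τ` in `σ ⊞ τ`. -/
noncomputable def boxInr (j : Fin τ.size) : Fin (σ.boxSum τ).size :=
  insertBlock σ.size τ.size τ.vline (Sum.inr j)

theorem perm_boxSum_insertBlock (k : Fin σ.size ⊕ Fin τ.size) :
    (σ.boxSum τ).perm (insertBlock σ.size τ.size τ.vline k) =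
      insertBlock σ.size τ.size τ.hline (Sum.map σ.perm τ.perm k) := by
  unfold boxSum
  simp

theorem point_boxInl (i : Fin σ.size) : (σ.boxSum τ).point (boxInl σ τ i) = σ.point i := by
  have h := congrArg Fin.val (perm_boxSum_insertBlock σ τ (Sum.inl i))
  simp only [point, boxInl, h]
  simp only [boxSum, insertBlock, Equiv.ofBijective_apply, insertBlockFun, Sum.map_inl]
  ext
  · push_cast; ring
  · push_cast; ring

theorem point_boxInr (j : Fin τ.size) : (σ.boxSum τ).point (boxInr σ τ j) =
    ((τ.point j).1 + if (j : ℕ) < τ.vline then -2 * (σ.vline : ℤ) else 2 * (σ.size - σ.vline : ℤ),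
     (τ.point j).2 +
      if (τ.perm j : ℕ) < τ.hline then -2 * (σ.hline : ℤ) else 2 * (σ.size - σ.hline : ℤ)) := by
  have h := congrArg Fin.val (perm_boxSum_insertBlock σ τ (Sum.inr j))
  simp only [point, boxInr, h]
  simp only [boxSum, insertBlock, Equiv.ofBijective_apply, insertBlockFun, Sum.map_inr]
  ext
  · simp only; split_ifs <;> push_cast <;> ring
  · simp only; split_ifs <;> push_cast <;> ring

theorem isGridMap_boxInl : IsGridMap σ.point (σ.boxSum τ).point (boxInl σ τ) := by
  simp [IsGridMap, point_boxInl]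

theorem isGridMap_boxInr : IsGridMap τ.point (σ.boxSum τ).point (boxInr σ τ) := by
  have hv := σ.vline.2
  have hh := σ.hline.2
  simp only [IsGridMap, point_boxInr]
  refine ⟨fun i j => ?_, fun i j => ?_, fun i => ?_, fun i => ?_⟩
  · simp only [point]; split_ifs <;> omega
  · simp only [point]; split_ifs <;> omega
  · simp only [point]; split_ifs <;> omega
  · simp only [point]; split_ifs <;> omega

theorem isBeyond_boxInl_boxInr (i : Fin σ.size) (j : Fin τ.size) :
    IsBeyond ((σ.boxSum τ).point (boxInl σ τ i)) ((σ.boxSum τ).point (boxInr σ τ j)) := by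
  have hv := σ.vline.2
  have hh := σ.hline.2
  have hi := i.2
  have hpi := (σ.perm i).2
  rw [point_boxInl, point_boxInr]
  simp only [IsBeyond, point]
  refine ⟨?_, ?_, ?_, ?_⟩ <;> split_ifs <;> omega

theorem forall_boxSum {P : Fin (σ.boxSum τ).size → Prop} :
    (∀ i, P i) ↔ (∀ i, P (boxInl σ τ i)) ∧ ∀ j, P (boxInr σ τ j) := by
  refine ⟨fun h => ⟨fun i => h _, fun j => h _⟩, fun h i => ?_⟩
  obtain ⟨i, rfl⟩ := (insertBlock σ.size τ.size τ.vline).surjective i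
  rcases i with i | j
  · exact h.1 i
  · exact h.2 j

theorem boxInl_ne_boxInr (i : Fin σ.size) (j : Fin τ.size) : boxInl σ τ i ≠ boxInr σ τ j :=
  fun h => Sum.inl_ne_inr ((insertBlock _ _ _).injective h)

theorem range_boxInr : Set.range (boxInr σ τ) = (Set.range (boxInl σ τ))ᶜ := by
  ext k
  revert k
  rw [forall_boxSum]
  refine ⟨fun i => ?_, fun j => ?_⟩
  · simp [(boxInl_ne_boxInr σ τ _ _).symm]
  · simp [boxInl_ne_boxInr σ τ _ _]

variable {σ τ}

/-- A set of points whose inner part has pattern `σ` and whose outer part has pattern `τ` has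
pattern `σ ⊞ τ`. -/
theorem exists_isGridMap_boxSum {q : ι → ℤ × ℤ} {f : Fin σ.size → ι} {g : Fin τ.size → ι}
    (hf : IsGridMap σ.point q f) (hg : IsGridMap τ.point q g)
    (hfg : ∀ i j, IsBeyond (q (f i)) (q (g j))) :
    ∃ h : Fin (σ.boxSum τ).size → ι, IsGridMap (σ.boxSum τ).point q h ∧
      (∀ i, h (boxInl σ τ i) = f i) ∧ ∀ j, h (boxInr σ τ j) = g j := by
  let h : Fin (σ.boxSum τ).size → ι :=
    fun k => Sum.elim f g ((insertBlock σ.size τ.size τ.vline).symm k)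
  have hl : ∀ i, h (boxInl σ τ i) = f i := fun i => by simp [h, boxInl]
  have hr : ∀ j, h (boxInr σ τ j) = g j := fun j => by simp [h, boxInr]
  refine ⟨h, ?_, hl, hr⟩
  have Hl := isGridMap_boxInl σ τ
  have Hr := isGridMap_boxInr σ τ
  have H := isBeyond_boxInl_boxInr σ τ
  have h0 := point_fst_ne_zero (σ.boxSum τ)
  have h0' := point_snd_ne_zero (σ.boxSum τ)
  simp only [IsGridMap, forall_boxSum, hl, hr]
  refine ⟨⟨fun i => ⟨fun j => ?_, fun j => ?_⟩, fun i => ⟨fun j => ?_, fun j => ?_⟩⟩,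
    ⟨fun i => ⟨fun j => ?_, fun j => ?_⟩, fun i => ⟨fun j => ?_, fun j => ?_⟩⟩,
    ⟨fun i => ?_, fun i => ?_⟩, ⟨fun i => ?_, fun i => ?_⟩⟩
  · rw [← Hl.1, hf.1]
  · have a := H i j
    have b := hfg i j
    have c := Hr.2.2.1 j
    have d := hg.2.2.1 j
    have := h0 (boxInr σ τ j)
    unfold IsBeyond at a b
    omega
  · have a := H j i
    have b := hfg j i
    have c := Hr.2.2.1 i
    have d := hg.2.2.1 i
    have := h0 (boxInr σ τ i)
    unfold IsBeyond at a b
    omega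
  · rw [← Hr.1, hg.1]
  · rw [← Hl.2.1, hf.2.1]
  · have a := H i j
    have b := hfg i j
    have c := Hr.2.2.2 j
    have d := hg.2.2.2 j
    have := h0' (boxInr σ τ j)
    unfold IsBeyond at a b
    omega
  · have a := H j i
    have b := hfg j i
    have c := Hr.2.2.2 i
    have d := hg.2.2.2 i
    have := h0' (boxInr σ τ i)
    unfold IsBeyond at a b
    omega
  · rw [← Hr.2.1, hg.2.1]
  · rw [← (Hl.2.2.1 i).1, ← (Hl.2.2.1 i).2]; exact hf.2.2.1 i
  · rw [← (Hr.2.2.1 i).1, ← (Hr.2.2.1 i).2]; exact hg.2.2.1 i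
  · rw [← (Hl.2.2.2 i).1, ← (Hl.2.2.2 i).2]; exact hf.2.2.2 i
  · rw [← (Hr.2.2.2 i).1, ← (Hr.2.2.2 i).2]; exact hg.2.2.2 i

/-- A set of points that is separated from the rest by a box around the origin splits off a box
summand. -/
theorem eq_boxSum_of_isBeyond {π : GriddedPerm} {f : Fin σ.size → Fin π.size}
    {g : Fin τ.size → Fin π.size} (hf : IsGridMap σ.point π.point f)
    (hg : IsGridMap τ.point π.point g) (hfg : ∀ i j, IsBeyond (π.point (f i)) (π.point (g j)))
    (hs : ∀ k, k ∈ Set.range f ∨ k ∈ Set.range g) : π = σ.boxSum τ := by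
  obtain ⟨h, hh, hl, hr⟩ := exists_isGridMap_boxSum hf hg hfg
  refine (eq_of_isGridMap hh fun k => ?_).symm
  rcases hs k with ⟨i, hi⟩ | ⟨j, hj⟩
  · exact ⟨_, (hl i).trans hi⟩
  · exact ⟨_, (hr j).trans hj⟩

theorem boxSum_assoc (σ τ ρ : GriddedPerm) :
    (σ.boxSum τ).boxSum ρ = σ.boxSum (τ.boxSum ρ) := by
  have hτρ : ∀ i j, IsBeyond (((σ.boxSum τ).boxSum ρ).point (boxInl _ _ (boxInr σ τ i)))
      (((σ.boxSum τ).boxSum ρ).point (boxInr _ _ j)) := fun i j => isBeyond_boxInl_boxInr _ _ _ _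
  obtain ⟨h, hh, hl, hr⟩ := exists_isGridMap_boxSum
    ((isGridMap_boxInl (σ.boxSum τ) ρ).comp (isGridMap_boxInr σ τ))
    (isGridMap_boxInr (σ.boxSum τ) ρ) hτρ
  refine eq_boxSum_of_isBeyond ((isGridMap_boxInl (σ.boxSum τ) ρ).comp (isGridMap_boxInl σ τ)) hh
    (fun i => ?_) ?_
  · rw [forall_boxSum]
    refine ⟨fun j => ?_, fun j => ?_⟩
    · rw [hl]
      exact ((isGridMap_boxInl (σ.boxSum τ) ρ).isBeyond_iff _ _).1 (isBeyond_boxInl_boxInr σ τ i j)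
    · rw [hr]
      exact isBeyond_boxInl_boxInr _ _ _ _
  · rw [forall_boxSum]
    refine ⟨?_, fun j => Or.inr ⟨_, hr j⟩⟩
    rw [forall_boxSum]
    exact ⟨fun i => Or.inl ⟨i, rfl⟩, fun i => Or.inr ⟨_, hl i⟩⟩

theorem boxSum_of_size_eq_zero (σ : GriddedPerm) (hτ : τ.size = 0) : σ.boxSum τ = σ := by
  have : IsEmpty (Fin τ.size) := by rw [hτ]; infer_instance
  refine (eq_of_isGridMap (isGridMap_boxInl σ τ) ?_).symm
  rw [Function.Surjective, forall_boxSum]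
  exact ⟨fun i => ⟨i, rfl⟩, fun j => isEmptyElim j⟩

theorem size_boxSum (σ τ : GriddedPerm) : (σ.boxSum τ).size = σ.size + τ.size := rfl

/-- The empty gridded permutation. -/
def empty : GriddedPerm := ⟨0, 1, 0, 0⟩

theorem exists_isBoxIndecomposable_boxSum (π : GriddedPerm) (hπ : 0 < π.size) :
    ∃ σ τ : GriddedPerm, σ.IsBoxIndecomposable ∧ π = σ.boxSum τ := by
  induction hn : π.size using Nat.strong_induction_on generalizing π with
  | _ n ih =>
    by_cases h : π.IsBoxIndecomposable
    · exact ⟨π, empty, h, (boxSum_of_size_eq_zero π rfl).symm⟩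
    · simp only [IsBoxIndecomposable, not_and, not_not] at h
      obtain ⟨σ, τ, hσ, hτ, rfl⟩ := h hπ
      rw [size_boxSum] at *
      obtain ⟨σ', ρ, hσ', rfl⟩ := ih σ.size (by omega) σ (by omega) rfl
      exact ⟨σ', ρ.boxSum τ, hσ', boxSum_assoc _ _ _⟩

/-- The pattern of a subset of the points of a gridded permutation. -/
theorem exists_isGridMap_range_eq (π : GriddedPerm) (A : Set (Fin π.size)) :
    ∃ (σ : GriddedPerm) (f : Fin σ.size → Fin π.size),
      IsGridMap σ.point π.point f ∧ Set.range f = A := by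
  classical
  obtain ⟨σ, f, hf, hb⟩ := exists_isGridMap_bijective (fun i : A => π.point i)
    (π.point_fst_injective.comp Subtype.val_injective)
    (π.point_snd_injective.comp Subtype.val_injective)
    (fun i => π.point_fst_ne_zero i) (fun i => π.point_snd_ne_zero i)
  refine ⟨σ, fun i => f i, (isGridMap_comp_right π.point (Subtype.val : A → _)).comp hf, ?_⟩
  rw [Set.range_comp' Subtype.val f, hb.2.range_eq]
  simp

/-- A gridded permutation is box indecomposable if no box around the origin separates some, but not
all, of its points from the others. -/
theorem isBoxIndecomposable_iff (π : GriddedPerm) :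
    π.IsBoxIndecomposable ↔ 0 < π.size ∧ ∀ A : Set (Fin π.size), A.Nonempty →
      (∀ i ∈ A, ∀ j ∉ A, IsBeyond (π.point i) (π.point j)) → A = Set.univ := by
  refine and_congr_right fun h0 => ⟨fun h A hA hb => ?_, ?_⟩
  · by_contra hne
    apply h
    obtain ⟨σ, f, hf, hfr⟩ := exists_isGridMap_range_eq π A
    obtain ⟨τ, g, hg, hgr⟩ := exists_isGridMap_range_eq π Aᶜ
    have key := eq_boxSum_of_isBeyond hf hg
      (fun i j => hb _ (hfr ▸ Set.mem_range_self i) _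
        (show g j ∈ Aᶜ from hgr ▸ Set.mem_range_self j))
      (fun k => by rw [hfr, hgr]; exact em (k ∈ A))
    have h1 : 0 < σ.size := by
      obtain ⟨a, ha⟩ := hA
      rw [← hfr] at ha
      obtain ⟨i, -⟩ := ha
      exact i.pos
    have h2 : 0 < τ.size := by
      obtain ⟨a, ha⟩ := Set.nonempty_compl.2 hne
      rw [← hgr] at ha
      obtain ⟨i, -⟩ := ha
      exact i.pos
    have h3 := congrArg size key
    rw [size_boxSum] at h3
    exact ⟨σ, τ, by omega, by omega, key⟩
  · rintro h ⟨σ, τ, hσ, hτ, rfl⟩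
    rw [size_boxSum] at hσ hτ
    have h1 := h (Set.range (boxInl σ τ)) ⟨boxInl σ τ ⟨0, by omega⟩, Set.mem_range_self _⟩ (by
      rintro _ ⟨i, rfl⟩ j hj
      rw [← Set.mem_compl_iff, ← range_boxInr] at hj
      obtain ⟨j, rfl⟩ := hj
      exact isBeyond_boxInl_boxInr σ τ i j)
    have h2 : boxInr σ τ ⟨0, by omega⟩ ∈ Set.range (boxInl σ τ) := h1 ▸ Set.mem_univ _
    rw [← Set.notMem_compl_iff, ← range_boxInr] at h2
    exact h2 (Set.mem_range_self _)

/-- The criterion of `isBoxIndecomposable_iff`, read off from any set of points that has the pattern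
`π`. -/
theorem isBoxIndecomposable_iff_of_isGridMap {π : GriddedPerm} {q : ι → ℤ × ℤ}
    {f : Fin π.size → ι} (hf : IsGridMap π.point q f) :
    π.IsBoxIndecomposable ↔ 0 < π.size ∧ ∀ A ⊆ Set.range f, A.Nonempty →
      (∀ a ∈ A, ∀ b ∈ Set.range f, b ∉ A → IsBeyond (q a) (q b)) → A = Set.range f := by
  rw [isBoxIndecomposable_iff]
  have hinj := hf.injective π.point_fst_injective
  refine and_congr_right fun _ => ⟨fun h A hA hne hb => ?_, fun h A hne hb => ?_⟩
  · have := h (f ⁻¹' A) (by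
      obtain ⟨a, ha⟩ := hne
      obtain ⟨i, rfl⟩ := hA ha
      exact ⟨i, ha⟩)
      (fun i hi j hj => (hf.isBeyond_iff i j).2 (hb _ hi _ (Set.mem_range_self j) hj))
    refine hA.antisymm ?_
    rintro _ ⟨i, rfl⟩
    exact (this ▸ Set.mem_univ i : i ∈ f ⁻¹' A)
  · have := h (f '' A) (Set.image_subset_range f A) (hne.image f) (by
      rintro _ ⟨i, hi, rfl⟩ _ ⟨j, rfl⟩ hj
      exact (hf.isBeyond_iff i j).1 (hb i hi j fun hj' => hj (Set.mem_image_of_mem f hj')))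
    rw [← Set.image_univ] at this
    exact hinj.image_injective this

/-- If no point lies below the horizontal axis, then the boxes that separate box summands are
nested, so the first box indecomposable summand is unique. -/
theorem boxSum_left_cancel_of_isBoxIndecomposable {σ τ σ' τ' : GriddedPerm}
    (hσ : σ.IsBoxIndecomposable) (hσ' : σ'.IsBoxIndecomposable)
    (h : σ.boxSum τ = σ'.boxSum τ') (hpos : ∀ i, 0 < ((σ.boxSum τ).point i).2) :
    σ = σ' ∧ τ = τ' := by
  -- the two decompositions as index sets of one gridded permutation `π`
  obtain ⟨π, hπ⟩ : ∃ π, π = σ.boxSum τ := ⟨_, rfl⟩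
  have data : ∀ α β : GriddedPerm, π = α.boxSum β → ∃ (f : Fin α.size → Fin π.size)
      (g : Fin β.size → Fin π.size), IsGridMap α.point π.point f ∧ IsGridMap β.point π.point g ∧
      (∀ i j, IsBeyond (π.point (f i)) (π.point (g j))) ∧ Set.range g = (Set.range f)ᶜ := by
    rintro α β rfl
    exact ⟨boxInl α β, boxInr α β, isGridMap_boxInl α β, isGridMap_boxInr α β,
      isBeyond_boxInl_boxInr α β, range_boxInr α β⟩
  obtain ⟨f, g, hf, hg, hfg, hr⟩ := data σ τ hπ
  obtain ⟨f', g', hf', hg', hfg', hr'⟩ := data σ' τ' (hπ.trans h)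
  rw [← hπ] at hpos
  have hcut : ∀ a ∈ Set.range f, ∀ b ∉ Set.range f, IsBeyond (π.point a) (π.point b) := by
    rintro _ ⟨i, rfl⟩ b hb
    rw [← Set.mem_compl_iff, ← hr] at hb
    obtain ⟨j, rfl⟩ := hb
    exact hfg i j
  have hcut' : ∀ a ∈ Set.range f', ∀ b ∉ Set.range f', IsBeyond (π.point a) (π.point b) := by
    rintro _ ⟨i, rfl⟩ b hb
    rw [← Set.mem_compl_iff, ← hr'] at hb
    obtain ⟨j, rfl⟩ := hb
    exact hfg' i j
  have hnest : Set.range f ⊆ Set.range f' ∨ Set.range f' ⊆ Set.range f := by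
    by_contra hcon
    simp only [not_or, Set.not_subset] at hcon
    obtain ⟨⟨a, ha, ha'⟩, b, hb', hb⟩ := hcon
    have h1 := (hcut a ha b hb).2.2.1 (hpos b)
    have h2 := (hcut' b hb' a ha').2.2.1 (hpos a)
    omega
  have hne : ∀ {α : GriddedPerm} (k : Fin α.size → Fin π.size), α.IsBoxIndecomposable →
      (Set.range k).Nonempty := fun k hα => ⟨k ⟨0, hα.1⟩, Set.mem_range_self _⟩
  have heq : Set.range f = Set.range f' := by
    rcases hnest with hs | hs
    · exact ((isBoxIndecomposable_iff_of_isGridMap hf').1 hσ').2 _ hs (hne f hσ)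
        fun a ha b _ hb => hcut a ha b hb
    · exact (((isBoxIndecomposable_iff_of_isGridMap hf).1 hσ).2 _ hs (hne f' hσ')
        fun a ha b _ hb => hcut' a ha b hb).symm
  exact ⟨eq_of_range_eq hf hf' heq, eq_of_range_eq hg hg' (by rw [hr, hr', heq])⟩

end BoxSum

/-! ### Counting box closed classes -/

theorem finite_setOf_size_eq (n : ℕ) : {π : GriddedPerm | π.size = n}.Finite := by
  refine (Set.finite_range fun t : Equiv.Perm (Fin n) × Fin (n + 1) × Fin (n + 1) =>
    (⟨n, t.1, t.2.1, t.2.2⟩ : GriddedPerm)).subset ?_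
  rintro ⟨m, p, v, h⟩ rfl
  exact ⟨(p, v, h), rfl⟩

theorem finite_setOf_mem_size_eq (C : Set GriddedPerm) (n : ℕ) :
    {π : GriddedPerm | π ∈ C ∧ π.size = n}.Finite :=
  (finite_setOf_size_eq n).subset fun _ h => h.2

/-- If no member of a box closed class has a point below the horizontal axis, then the class is the
free monoid, under the box sum, on its box indecomposable members. -/
theorem count_eq_sum_antidiagonal {C : Set GriddedPerm} (hbox : IsBoxClosed C)
    (hdown : ∀ σ τ, GriddedPerm.boxSum σ τ ∈ C → σ ∈ C ∧ τ ∈ C)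
    (hpos : ∀ π ∈ C, ∀ i, 0 < (GriddedPerm.point π i).2) {n : ℕ} (hn : 0 < n) :
    count C n = ∑ p ∈ Finset.HasAntidiagonal.antidiagonal n,
      count {π | π ∈ C ∧ π.IsBoxIndecomposable} p.1 * count C p.2 := by
  classical
  have hC := finite_setOf_mem_size_eq C
  have hG := finite_setOf_mem_size_eq {π | π ∈ C ∧ π.IsBoxIndecomposable}
  have hcount : ∀ m, count C m = (hC m).toFinset.card :=
    fun m => Set.ncard_eq_toFinset_card _ (hC m)
  have hcountG : ∀ m, count {π | π ∈ C ∧ π.IsBoxIndecomposable} m = (hG m).toFinset.card :=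
    fun m => Set.ncard_eq_toFinset_card _ (hG m)
  simp only [hcount, hcountG, ← Finset.card_product]
  rw [← Finset.card_sigma]
  symm
  refine Finset.card_bij (fun t _ => GriddedPerm.boxSum t.2.1 t.2.2) ?_ ?_ ?_
  · rintro ⟨p, σ, τ⟩ h
    simp only [Finset.mem_sigma, Finset.HasAntidiagonal.mem_antidiagonal, Finset.mem_product,
      Set.Finite.mem_toFinset, Set.mem_ofPred_eq] at h ⊢
    obtain ⟨h1, ⟨⟨h2, -⟩, h3⟩, h4, h5⟩ := h
    exact ⟨hbox _ h2 _ h4, by rw [size_boxSum]; omega⟩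
  · rintro ⟨⟨a, b⟩, σ, τ⟩ h ⟨⟨a', b'⟩, σ', τ'⟩ h' e
    simp only [Finset.mem_sigma, Finset.HasAntidiagonal.mem_antidiagonal, Finset.mem_product,
      Set.Finite.mem_toFinset, Set.mem_ofPred_eq] at h h' e
    obtain ⟨h1, ⟨⟨h2, h2i⟩, h3⟩, h4, h5⟩ := h
    obtain ⟨h1', ⟨⟨h2', h2i'⟩, h3'⟩, h4', h5'⟩ := h'
    obtain ⟨rfl, rfl⟩ := boxSum_left_cancel_of_isBoxIndecomposable h2i h2i' e
      (hpos _ (hbox _ h2 _ h4))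
    subst h3 h5 h3' h5'
    rfl
  · intro π h
    simp only [Set.Finite.mem_toFinset, Set.mem_ofPred_eq] at h
    obtain ⟨σ, τ, hσ, rfl⟩ := exists_isBoxIndecomposable_boxSum π (by omega)
    obtain ⟨h1, h2⟩ := hdown _ _ h.1
    refine ⟨⟨(σ.size, τ.size), σ, τ⟩, ?_, rfl⟩
    simp only [Finset.mem_sigma, Finset.HasAntidiagonal.mem_antidiagonal, Finset.mem_product,
      Set.Finite.mem_toFinset, Set.mem_ofPred_eq]
    exact ⟨by rw [← size_boxSum]; exact h.2, ⟨⟨h1, hσ⟩, trivial⟩, h2, trivial⟩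

theorem count_zero {C : Set GriddedPerm} (h : empty ∈ C) : count C 0 = 1 := by
  rw [count, Set.ncard_eq_one]
  refine ⟨empty, Set.eq_singleton_iff_unique_mem.2 ⟨⟨h, rfl⟩, ?_⟩⟩
  rintro π ⟨-, hπ⟩
  have : IsEmpty (Fin π.size) := by rw [hπ]; infer_instance
  have : IsEmpty (Fin empty.size) := inferInstanceAs (IsEmpty (Fin 0))
  exact eq_of_isGridMap (f := isEmptyElim)
    ⟨fun i => isEmptyElim i, fun i => isEmptyElim i, fun i => isEmptyElim i,
      fun i => isEmptyElim i⟩ fun i => isEmptyElim i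

theorem count_isBoxIndecomposable_zero (C : Set GriddedPerm) :
    count {π | π ∈ C ∧ π.IsBoxIndecomposable} 0 = 0 := by
  rw [count, Set.ncard_eq_zero (finite_setOf_mem_size_eq _ _)]
  refine Set.eq_empty_of_forall_notMem ?_
  rintro π ⟨⟨-, h⟩, h0⟩
  have := h.1
  omega

/-- The generating function of a box closed class above the horizontal axis is `1 / (1 - g)`, where
`g` counts the box indecomposable members. -/
theorem mk_count_mul_one_sub_boxIndecGF {C : Set GriddedPerm} (hbox : IsBoxClosed C)
    (hdown : ∀ σ τ, GriddedPerm.boxSum σ τ ∈ C → σ ∈ C ∧ τ ∈ C)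
    (hpos : ∀ π ∈ C, ∀ i, 0 < (GriddedPerm.point π i).2) (hempty : empty ∈ C) :
    (PowerSeries.mk fun n => (count C n : ℚ)) * (1 - boxIndecGF C) = 1 := by
  have : (PowerSeries.mk fun n => (count C n : ℚ)) =
      1 + boxIndecGF C * PowerSeries.mk fun n => (count C n : ℚ) := by
    ext n
    rw [map_add, PowerSeries.coeff_mul, PowerSeries.coeff_one]
    simp only [boxIndecGF, PowerSeries.coeff_mk]
    rcases Nat.eq_zero_or_pos n with rfl | hn
    · simp [count_zero hempty, count_isBoxIndecomposable_zero]
    · rw [if_neg hn.ne', zero_add, count_eq_sum_antidiagonal hbox hdown hpos hn]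
      push_cast
      rfl
  linear_combination this

end GriddedPerm

/-! ### The growth rate from the recurrence -/

theorem quintic_expand (x : ℝ) : x ^ 5 - 4 * x ^ 4 + 3 * x ^ 3 - 2 * x ^ 2 - x + 2 =
    (x - 3) ^ 5 + 11 * (x - 3) ^ 4 + 45 * (x - 3) ^ 3 + 79 * (x - 3) ^ 2 + 41 * (x - 3) - 19 := by
  ring

/-- The Taylor coefficients of the quintic at `3` are positive except for the constant one, so it is
strictly increasing from there on. -/
theorem quintic_lt_quintic {x y : ℝ} (hx : 3 ≤ x) (hxy : x < y) :
    x ^ 5 - 4 * x ^ 4 + 3 * x ^ 3 - 2 * x ^ 2 - x + 2 <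
      y ^ 5 - 4 * y ^ 4 + 3 * y ^ 3 - 2 * y ^ 2 - y + 2 := by
  rw [quintic_expand x, quintic_expand y]
  have h0 : 0 ≤ x - 3 := by linarith
  have h1 : x - 3 < y - 3 := by linarith
  gcongr

theorem exists_isGreatest_quintic_root : ∃ μ : ℝ,
    IsGreatest {x : ℝ | x ^ 5 - 4 * x ^ 4 + 3 * x ^ 3 - 2 * x ^ 2 - x + 2 = 0} μ ∧
      3.282765 < μ ∧ μ < 3.282775 := by
  have hcont : ContinuousOn
      (fun x : ℝ => x ^ 5 - 4 * x ^ 4 + 3 * x ^ 3 - 2 * x ^ 2 - x + 2)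
      (Set.Icc 3.282765 3.282775) := by fun_prop
  obtain ⟨μ, hμ, h0⟩ := intermediate_value_Ioo (by norm_num) hcont
    (show (0 : ℝ) ∈ _ by constructor <;> norm_num)
  refine ⟨μ, ⟨h0, fun y hy => ?_⟩, hμ.1, hμ.2⟩
  by_contra hlt
  have := quintic_lt_quintic (by linarith [hμ.1]) (not_le.1 hlt)
  simp only [Set.mem_ofPred_eq] at hy
  simp only at h0
  linarith

theorem tendsto_const_mul_pow_root {c μ : ℝ} (hc : 0 < c) (hμ : 0 < μ) :
    Tendsto (fun n : ℕ => (c * μ ^ n) ^ (1 / (n : ℝ))) atTop (𝓝 μ) := by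
  have h1 : Tendsto (fun n : ℕ => c ^ (1 / (n : ℝ)) * μ) atTop (𝓝 (c ^ (0 : ℝ) * μ)) :=
    ((Real.continuousAt_const_rpow hc.ne').tendsto.comp
      tendsto_one_div_atTop_nhds_zero_nat).mul_const μ
  rw [Real.rpow_zero, one_mul] at h1
  refine h1.congr' ?_
  filter_upwards [eventually_ne_atTop 0] with n hn
  rw [Real.mul_rpow hc.le (by positivity), one_div, Real.pow_rpow_inv_natCast hμ.le hn]

/-- The combination `a (n+4) + q₁ a (n+3) + … + q₄ a n`, whose coefficients are those of the
quotient of the characteristic polynomial by `z - μ`, is a geometric progression of ratio `μ`;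
since `a` at least doubles at every step, the combination is comparable with `a (n+4)`. -/
theorem tendsto_root_of_recurrence {a : ℕ → ℝ} {μ : ℝ} (hlo : 3.28 < μ) (hhi : μ < 3.29)
    (hμ : μ ^ 5 - 4 * μ ^ 4 + 3 * μ ^ 3 - 2 * μ ^ 2 - μ + 2 = 0)
    (hpos : ∀ n, 0 < a n) (hdbl : ∀ n, 2 * a n ≤ a (n + 1))
    (hrec : ∀ n, a (n + 5) =
      4 * a (n + 4) - 3 * a (n + 3) + 2 * a (n + 2) + a (n + 1) - 2 * a n) :
    Tendsto (fun n : ℕ => a n ^ (1 / (n : ℝ))) atTop (𝓝 μ) := by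
  obtain ⟨q₁, hq₁⟩ : ∃ q, q = μ - 4 := ⟨_, rfl⟩
  obtain ⟨q₂, hq₂⟩ : ∃ q, q = μ * q₁ + 3 := ⟨_, rfl⟩
  obtain ⟨q₃, hq₃⟩ : ∃ q, q = μ * q₂ - 2 := ⟨_, rfl⟩
  obtain ⟨q₄, hq₄⟩ : ∃ q, q = μ * q₃ - 1 := ⟨_, rfl⟩
  have hq : μ * q₄ = -2 := by
    rw [hq₄, hq₃, hq₂, hq₁]
    linear_combination hμ
  have b₁ : -0.72 < q₁ ∧ q₁ < -0.71 := by constructor <;> linarith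
  have b₂ : 0 < q₂ ∧ q₂ < 0.68 := by constructor <;> nlinarith
  have b₃ : 0 < q₃ ∧ q₃ < 0.24 := by
    rw [hq₃, hq₂, hq₁]
    constructor <;> nlinarith
  have b₄ : -0.61 < q₄ ∧ q₄ < 0 := by constructor <;> nlinarith
  let A : ℕ → ℝ := fun n => a (n + 4) + q₁ * a (n + 3) + q₂ * a (n + 2) + q₃ * a (n + 1) + q₄ * a n
  have hA : ∀ n, A (n + 1) = μ * A n := by
    intro n
    change a (n + 5) + q₁ * a (n + 4) + q₂ * a (n + 3) + q₃ * a (n + 2) + q₄ * a (n + 1) =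
      μ * (a (n + 4) + q₁ * a (n + 3) + q₂ * a (n + 2) + q₃ * a (n + 1) + q₄ * a n)
    rw [hrec n]
    linear_combination a (n + 4) * hq₁ + a (n + 3) * hq₂ + a (n + 2) * hq₃ + a (n + 1) * hq₄
      - a n * hq
  have hApow : ∀ n, A n = A 0 * μ ^ n := by
    intro n
    induction n with
    | zero => simp
    | succ n ih => rw [hA, ih]; ring
  have hbound : ∀ n, a (n + 4) ≤ 2 * A n ∧ A n ≤ 2 * a (n + 4) := by
    intro n
    have d0 := hdbl n
    have d1 : 2 * a (n + 1) ≤ a (n + 2) := hdbl (n + 1)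
    have d2 : 2 * a (n + 2) ≤ a (n + 3) := hdbl (n + 2)
    have d3 : 2 * a (n + 3) ≤ a (n + 4) := hdbl (n + 3)
    have p0 := hpos n
    have p1 := hpos (n + 1)
    have p2 := hpos (n + 2)
    have p3 := hpos (n + 3)
    have p4 := hpos (n + 4)
    change _ ≤ 2 * (a (n + 4) + q₁ * a (n + 3) + q₂ * a (n + 2) + q₃ * a (n + 1) + q₄ * a n) ∧
      a (n + 4) + q₁ * a (n + 3) + q₂ * a (n + 2) + q₃ * a (n + 1) + q₄ * a n ≤ _
    have l1 : -0.72 * a (n + 3) ≤ q₁ * a (n + 3) := by gcongr; exact b₁.1.le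
    have u1 : q₁ * a (n + 3) ≤ 0 := by nlinarith
    have l2 : 0 ≤ q₂ * a (n + 2) := mul_nonneg b₂.1.le p2.le
    have u2 : q₂ * a (n + 2) ≤ 0.68 * a (n + 2) := by gcongr; exact b₂.2.le
    have l3 : 0 ≤ q₃ * a (n + 1) := mul_nonneg b₃.1.le p1.le
    have u3 : q₃ * a (n + 1) ≤ 0.24 * a (n + 1) := by gcongr; exact b₃.2.le
    have l4 : -0.61 * a n ≤ q₄ * a n := by gcongr; exact b₄.1.le
    have u4 : q₄ * a n ≤ 0 := by nlinarith
    constructor <;> linarith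
  have hA0 : 0 < A 0 := by
    have := (hbound 0).1
    have := hpos (0 + 4)
    linarith
  have hμ0 : 0 < μ := by linarith
  have hlow := tendsto_const_mul_pow_root (c := A 0 / 2 / μ ^ 4) (by positivity) hμ0
  have hupp := tendsto_const_mul_pow_root (c := 2 * A 0 / μ ^ 4) (by positivity) hμ0
  refine tendsto_of_tendsto_of_tendsto_of_le_of_le' hlow hupp ?_ ?_
  · filter_upwards [eventually_ge_atTop 4] with n hn
    obtain ⟨m, rfl⟩ := Nat.exists_eq_add_of_le' hn
    have := (hbound m).2
    rw [hApow] at this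
    gcongr
    rw [pow_add, div_mul_eq_mul_div, ← mul_assoc, mul_div_cancel_right₀ _ (by positivity)]
    linarith
  · filter_upwards [eventually_ge_atTop 4] with n hn
    obtain ⟨m, rfl⟩ := Nat.exists_eq_add_of_le' hn
    have := (hbound m).1
    rw [hApow] at this
    have := (hpos (m + 4)).le
    gcongr
    rw [pow_add, div_mul_eq_mul_div, ← mul_assoc, mul_div_cancel_right₀ _ (by positivity)]
    linarith

open PowerSeries in
theorem recurrence_of_mul_one_sub {a : ℕ → ℚ} {g : PowerSeries ℚ}
    (h : PowerSeries.mk a * (1 - g) = 1)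
    (hg : g = (2 * X - 2 * X ^ 2 + 2 * X ^ 3 + X ^ 4 - 2 * X ^ 5) * ((1 - X) ^ 2)⁻¹) (n : ℕ) :
    a (n + 5) = 4 * a (n + 4) - 3 * a (n + 3) + 2 * a (n + 2) + a (n + 1) - 2 * a n := by
  have hc : constantCoeff ((1 - X : PowerSeries ℚ) ^ 2) ≠ 0 := by simp
  rw [PowerSeries.eq_mul_inv_iff_mul_eq hc] at hg
  have key : PowerSeries.mk a - C 4 * (PowerSeries.mk a * X ^ 1) + C 3 * (PowerSeries.mk a * X ^ 2)
      - C 2 * (PowerSeries.mk a * X ^ 3) - PowerSeries.mk a * X ^ 4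
      + C 2 * (PowerSeries.mk a * X ^ 5) = 1 - C 2 * X ^ 1 + X ^ 2 := by
    simp only [map_ofNat]
    linear_combination (1 - X) ^ 2 * h + PowerSeries.mk a * hg
  have := congrArg (coeff (n + 5)) key
  simp only [map_add, map_sub, coeff_C_mul] at this
  rw [show n + 5 = (n + 4) + 1 from rfl, coeff_mul_X_pow, show n + 4 + 1 = (n + 3) + 2 from rfl,
    coeff_mul_X_pow, show n + 3 + 2 = (n + 2) + 3 from rfl, coeff_mul_X_pow,
    show n + 2 + 3 = (n + 1) + 4 from rfl, coeff_mul_X_pow, show n + 1 + 4 = n + 5 from rfl,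
    coeff_mul_X_pow] at this
  simp only [coeff_mk, coeff_X_pow, coeff_one] at this
  simp at this
  linarith

/-! ### Factor complexity and Sturmian words -/

theorem ncard_range_le_of_imp {α β γ : Type*} [Finite γ] {f : α → β} {g : α → γ}
    (h : ∀ a b, g a = g b → f a = f b) : (Set.range f).ncard ≤ (Set.range g).ncard := by
  classical
  have hfac : ∀ c : Set.range g, ∃ a, g a = c := fun c => c.2
  choose r hr using hfac
  have : Set.range f ⊆ Set.range fun c => f (r c) := by
    rintro _ ⟨a, rfl⟩
    exact ⟨⟨g a, a, rfl⟩, h _ _ (hr _)⟩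
  refine (Set.ncard_le_ncard this (Set.finite_range _)).trans ?_
  rw [← Set.image_univ, ← Nat.card_coe_set_eq (Set.range g), ← Set.ncard_univ]
  exact Set.ncard_image_le Set.finite_univ

theorem ncard_range_eq_of_iff {α β γ : Type*} [Finite γ] {f : α → β} {g : α → γ}
    (h : ∀ a b, f a = f b ↔ g a = g b) : (Set.range f).ncard = (Set.range g).ncard := by
  have e : Set.range f ≃ Set.range g :=
    (Setoid.quotientKerEquivRange f).symm.trans
      ((Quotient.congrRight fun a b => h a b).trans (Setoid.quotientKerEquivRange g))
  rw [← Nat.card_coe_set_eq, ← Nat.card_coe_set_eq]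
  exact Nat.card_congr e

/-- The factor of length `n` of `s` that starts at position `k`. -/
def factorAt (s : ℕ → Bool) (n k : ℕ) : Fin n → Bool := fun i => s (k + i)

theorem factorAt_eq_iff {s s' : ℕ → Bool} {n k k' : ℕ} :
    factorAt s n k = factorAt s' n k' ↔ ∀ i < n, s (k + i) = s' (k' + i) :=
  ⟨fun h i hi => congrFun h ⟨i, hi⟩, fun h => funext fun i => h i i.2⟩

theorem factorComplexity_eq (s : ℕ → Bool) (n : ℕ) :
    factorComplexity s n = (Set.range (factorAt s n)).ncard := by
  unfold factorComplexity
  congr 1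
  ext u
  constructor
  · rintro ⟨k, hk⟩
    exact ⟨k, funext fun i => (hk i).symm⟩
  · rintro ⟨k, rfl⟩
    exact ⟨k, fun i => rfl⟩

theorem factorComplexity_zero (s : ℕ → Bool) : factorComplexity s 0 = 1 := by
  rw [factorComplexity_eq, Set.ncard_eq_one]
  exact ⟨factorAt s 0 0, Set.eq_singleton_iff_unique_mem.2
    ⟨Set.mem_range_self _, fun _ _ => Subsingleton.elim _ _⟩⟩

theorem exists_factorComplexity_succ_le {s : ℕ → Bool} {n : ℕ} (h : factorComplexity s n ≤ n) :
    ∃ m, factorComplexity s (m + 1) ≤ factorComplexity s m := by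
  by_contra! hcon
  have : ∀ m, m + 1 ≤ factorComplexity s m := by
    intro m
    induction m with
    | zero => rw [factorComplexity_zero]
    | succ m ih => have := hcon m; omega
  have := this n
  omega

/-- If there are no more factors of length `m + 1` than of length `m`, then every factor of length
`m` extends uniquely to the right, and so determines everything that follows it. -/
theorem forall_eq_of_factorComplexity_succ_le {s : ℕ → Bool} {m : ℕ}
    (h : factorComplexity s (m + 1) ≤ factorComplexity s m) {i j : ℕ}
    (hij : ∀ r < m, s (i + r) = s (j + r)) (k : ℕ) : s (i + k) = s (j + k) := by
  rw [factorComplexity_eq, factorComplexity_eq] at h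
  let r : (Fin (m + 1) → Bool) → Fin m → Bool := fun u t => u t.castSucc
  have himg : r '' Set.range (factorAt s (m + 1)) = Set.range (factorAt s m) := by
    rw [← Set.range_comp]
    rfl
  have hinj : Set.InjOn r (Set.range (factorAt s (m + 1))) := by
    refine Set.injOn_of_ncard_image_eq ?_ (Set.toFinite _)
    refine le_antisymm (Set.ncard_image_le (Set.toFinite _)) ?_
    rw [himg]
    exact h
  have hext : ∀ i j : ℕ, (∀ r < m, s (i + r) = s (j + r)) → ∀ r < m + 1, s (i + r) = s (j + r) := by
    intro i j hij
    have := hinj ⟨i, rfl⟩ ⟨j, rfl⟩ (funext fun t => hij t t.2)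
    exact factorAt_eq_iff.1 this
  have hall : ∀ k, ∀ r < m, s (i + k + r) = s (j + k + r) := by
    intro k
    induction k with
    | zero => exact hij
    | succ k ih =>
      intro r hr
      have := hext _ _ ih (r + 1) (by omega)
      rw [show i + (k + 1) + r = i + k + (r + 1) by ring,
        show j + (k + 1) + r = j + k + (r + 1) by ring]
      exact this
  exact hext _ _ (hall k) 0 (by omega)

/-- Every factor of a Sturmian word occurs infinitely often: otherwise some tail of the word has at
most `n` factors of length `n`, hence bounded factor complexity. -/
theorem IsSturmian.exists_ge_forall_eq {s : ℕ → Bool} (hs : IsSturmian s) (n k M : ℕ) :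
    ∃ k' ≥ M, ∀ i < n, s (k' + i) = s (k + i) := by
  by_contra! hcon
  let t : ℕ → Bool := fun i => s (M + i)
  have hts : ∀ L j, factorAt t L j = factorAt s L (M + j) := fun L j =>
    factorAt_eq_iff.2 fun i _ => by simp only [t]; rw [add_assoc]
  have hlt : factorComplexity t n < factorComplexity s n := by
    rw [factorComplexity_eq, factorComplexity_eq]
    refine Set.ncard_lt_ncard ⟨?_, fun hsub => ?_⟩ (Set.toFinite _)
    · rintro _ ⟨j, rfl⟩
      exact ⟨M + j, (hts n j).symm⟩
    · obtain ⟨j, hj⟩ := hsub ⟨k, rfl⟩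
      rw [hts, factorAt_eq_iff] at hj
      obtain ⟨i, hi, hne⟩ := hcon (M + j) (by omega)
      exact hne (hj i hi)
  rw [hs n] at hlt
  obtain ⟨m, hm⟩ := exists_factorComplexity_succ_le (Nat.lt_succ_iff.1 hlt)
  have hbdd : ∀ L, factorComplexity t L ≤ factorComplexity t m := by
    intro L
    rw [factorComplexity_eq, factorComplexity_eq]
    refine ncard_range_le_of_imp fun i j hij => ?_
    exact factorAt_eq_iff.2 fun r _ =>
      forall_eq_of_factorComplexity_succ_le hm (factorAt_eq_iff.1 hij) r
  have hsub : ∀ L, factorComplexity s L ≤ M + factorComplexity t L := by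
    intro L
    have : Set.range (factorAt s L) ⊆
        factorAt s L '' (Finset.range M : Set ℕ) ∪ Set.range (factorAt t L) := by
      rintro _ ⟨j, rfl⟩
      rcases lt_or_ge j M with hj | hj
      · exact Or.inl ⟨j, by simpa using hj, rfl⟩
      · exact Or.inr ⟨j - M, by rw [hts, Nat.add_sub_cancel' hj]⟩
    rw [factorComplexity_eq, factorComplexity_eq]
    refine (Set.ncard_le_ncard this (Set.toFinite _)).trans ((Set.ncard_union_le _ _).trans ?_)
    gcongr
    refine (Set.ncard_image_le (Finset.finite_toSet _)).trans ?_
    rw [Set.ncard_coe_finset, Finset.card_range]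
  have h1 := hsub (M + factorComplexity t m)
  have h2 := hbdd (M + factorComplexity t m)
  rw [hs] at h1
  omega

/-! ### Mechanical words -/

/-- The mechanical word of slope `α`: the differences of the sequence `⌊n α⌋`. -/
noncomputable def mechanicalWord (α : ℝ) (n : ℕ) : Bool :=
  decide (⌊((n + 1 : ℕ) : ℝ) * α⌋ ≠ ⌊(n : ℝ) * α⌋)

theorem floor_succ_mul {α : ℝ} (h0 : 0 < α) (h1 : α < 1) (n : ℕ) :
    ⌊((n + 1 : ℕ) : ℝ) * α⌋ = ⌊(n : ℝ) * α⌋ + if mechanicalWord α n then 1 else 0 := by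
  have hle : ⌊(n : ℝ) * α⌋ ≤ ⌊((n + 1 : ℕ) : ℝ) * α⌋ := by
    apply Int.floor_le_floor
    push_cast
    nlinarith
  have hlt : ⌊((n + 1 : ℕ) : ℝ) * α⌋ < ⌊(n : ℝ) * α⌋ + 2 := by
    rw [Int.floor_lt]
    push_cast
    have := Int.lt_floor_add_one ((n : ℝ) * α)
    nlinarith
  by_cases h : ⌊((n + 1 : ℕ) : ℝ) * α⌋ = ⌊(n : ℝ) * α⌋
  · have : mechanicalWord α n = false := by simpa [mechanicalWord] using h
    rw [h, this]; simp
  · have : mechanicalWord α n = true := by simpa [mechanicalWord] using h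
    simp only [this, if_true]
    omega

/-- Equal factors of mechanical words have equal numbers of ones. -/
theorem floor_sub_floor_eq {α β : ℝ} (hα0 : 0 < α) (hα1 : α < 1) (hβ0 : 0 < β) (hβ1 : β < 1)
    {n k k' : ℕ} (h : ∀ i < n, mechanicalWord α (k + i) = mechanicalWord β (k' + i)) :
    ⌊((k + n : ℕ) : ℝ) * α⌋ - ⌊(k : ℝ) * α⌋ = ⌊((k' + n : ℕ) : ℝ) * β⌋ - ⌊(k' : ℝ) * β⌋ := by
  induction n with
  | zero => simp
  | succ n ih =>
    have := ih fun i hi => h i (by omega)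
    rw [← add_assoc, ← add_assoc, floor_succ_mul hα0 hα1, floor_succ_mul hβ0 hβ1, h n (by omega)]
    omega

theorem abs_floor_sub_floor_sub_lt (α : ℝ) (k n : ℕ) :
    |((⌊((k + n : ℕ) : ℝ) * α⌋ - ⌊(k : ℝ) * α⌋ : ℤ) : ℝ) - n * α| < 1 := by
  have h1 := Int.floor_le (((k + n : ℕ) : ℝ) * α)
  have h2 := Int.lt_floor_add_one (((k + n : ℕ) : ℝ) * α)
  have h3 := Int.floor_le ((k : ℝ) * α)
  have h4 := Int.lt_floor_add_one ((k : ℝ) * α)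
  push_cast at *
  rw [abs_lt]
  constructor <;> linarith

theorem eq_zero_of_forall_nat_mul_lt {x c : ℝ} (h : ∀ n : ℕ, 2 ≤ n → |n * x| < c) : x = 0 := by
  by_contra hx
  have hx' := abs_pos.2 hx
  obtain ⟨n, hn⟩ := exists_nat_gt (c / |x|)
  have := h (n + 2) (by omega)
  rw [abs_mul, Nat.abs_cast] at this
  rw [div_lt_iff₀ hx'] at hn
  push_cast at this
  nlinarith

/-- The slope of a mechanical word is determined by its long factors. -/
theorem slope_eq_of_common_factors {α β : ℝ} (hα0 : 0 < α) (hα1 : α < 1) (hβ0 : 0 < β) (hβ1 : β < 1)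
    (h : ∀ n, 2 ≤ n → ∃ k k', ∀ i < n, mechanicalWord α (k + i) = mechanicalWord β (k' + i)) :
    α = β := by
  refine sub_eq_zero.1 (eq_zero_of_forall_nat_mul_lt (c := 2) fun n hn => ?_)
  obtain ⟨k, k', hk⟩ := h n hn
  have e := floor_sub_floor_eq hα0 hα1 hβ0 hβ1 hk
  have h1 := abs_floor_sub_floor_sub_lt α k n
  have h2 := abs_floor_sub_floor_sub_lt β k' n
  rw [e] at h1
  rw [abs_lt] at *
  constructor <;> linarith [h1.1, h1.2, h2.1, h2.2]

/-- The word at position `k` is governed by the numbers `⌊{k α} + j α⌋`.  They increase with the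
fractional part `{k α}` and take two values each, so their sum over `1 ≤ j ≤ n` determines them all
and takes at most `n + 1` values. -/
theorem factorComplexity_mechanicalWord_le (α : ℝ) (n : ℕ) :
    factorComplexity (mechanicalWord α) n ≤ n + 1 := by
  let D : ℕ → ℕ → ℤ := fun k j => ⌊Int.fract ((k : ℝ) * α) + j * α⌋
  have hD : ∀ k j : ℕ, D k j = ⌊((k + j : ℕ) : ℝ) * α⌋ - ⌊(k : ℝ) * α⌋ := by
    intro k j
    change ⌊Int.fract ((k : ℝ) * α) + j * α⌋ = _
    rw [← Int.floor_sub_intCast, ← Int.self_sub_floor]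
    congr 1
    push_cast
    ring
  have hlow : ∀ k j : ℕ, ⌊(j : ℝ) * α⌋ ≤ D k j := fun k j =>
    Int.floor_le_floor (by linarith [Int.fract_nonneg ((k : ℝ) * α)])
  have hupp : ∀ k j : ℕ, D k j ≤ ⌊(j : ℝ) * α⌋ + 1 := by
    intro k j
    rw [← Int.floor_add_one]
    exact Int.floor_le_floor (by linarith [Int.fract_lt_one ((k : ℝ) * α)])
  let B : ℤ := ∑ j ∈ Finset.range n, ⌊((j + 1 : ℕ) : ℝ) * α⌋
  have hmem : ∀ k, ∑ j ∈ Finset.range n, D k (j + 1) ∈ Set.Icc B (B + n) := by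
    intro k
    refine ⟨Finset.sum_le_sum fun j _ => hlow k (j + 1), ?_⟩
    refine (Finset.sum_le_sum fun j _ => hupp k (j + 1)).trans ?_
    rw [Finset.sum_add_distrib]
    simp [B]
  have hdet : ∀ k k', ∑ j ∈ Finset.range n, D k (j + 1) = ∑ j ∈ Finset.range n, D k' (j + 1) →
      ∀ j ∈ Finset.range n, D k (j + 1) = D k' (j + 1) := by
    intro k k' he
    rcases le_total (Int.fract ((k : ℝ) * α)) (Int.fract ((k' : ℝ) * α)) with hle | hle
    · exact (Finset.sum_eq_sum_iff_of_le fun j _ =>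
        Int.floor_le_floor (by linarith)).1 he
    · intro j hj
      exact ((Finset.sum_eq_sum_iff_of_le fun j _ =>
        Int.floor_le_floor (by linarith)).1 he.symm j hj).symm
  have hfac : ∀ k k', (∀ j ∈ Finset.range n, D k (j + 1) = D k' (j + 1)) →
      factorAt (mechanicalWord α) n k = factorAt (mechanicalWord α) n k' := by
    intro k k' he
    refine factorAt_eq_iff.2 fun i hi => ?_
    have h1 := he i (Finset.mem_range.2 hi)
    have h0 : D k i = D k' i := by
      rcases i with _ | i
      · simp [hD]
      · exact he i (Finset.mem_range.2 (by omega))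
    rw [hD, hD, ← add_assoc, ← add_assoc] at h1
    rw [hD, hD] at h0
    simp only [mechanicalWord, decide_eq_decide]
    omega
  rw [factorComplexity_eq]
  calc (Set.range (factorAt (mechanicalWord α) n)).ncard
      ≤ (Set.range fun k => (⟨_, hmem k⟩ : Set.Icc B (B + n))).ncard :=
        ncard_range_le_of_imp fun k k' he => hfac k k' (hdet k k' (congrArg Subtype.val he))
    _ ≤ Nat.card (Set.Icc B (B + n)) := by
        rw [← Set.ncard_univ]
        exact Set.ncard_le_ncard (Set.subset_univ _)
    _ = n + 1 := by
        rw [Nat.card_eq_fintype_card]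
        simp
        omega

theorem isSturmian_mechanicalWord {α : ℝ} (h0 : 0 < α) (h1 : α < 1) (hα : Irrational α) :
    IsSturmian (mechanicalWord α) := by
  intro n
  refine le_antisymm (factorComplexity_mechanicalWord_le α n) ?_
  by_contra hlt
  obtain ⟨m, hm⟩ := exists_factorComplexity_succ_le (Nat.lt_succ_iff.1 (not_le.1 hlt))
  -- two positions with the same factor of length `m` make the word eventually periodic
  obtain ⟨i, q, hq, hper⟩ : ∃ i q : ℕ, 0 < q ∧
      ∀ k, mechanicalWord α (i + k) = mechanicalWord α (i + q + k) := by
    obtain ⟨i, j, hne, he⟩ := Finite.exists_ne_map_eq_of_infinite (factorAt (mechanicalWord α) m)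
    have hall := forall_eq_of_factorComplexity_succ_le hm (factorAt_eq_iff.1 he)
    rcases lt_or_gt_of_ne hne with h | h
    · exact ⟨i, j - i, by omega, fun k => by rw [Nat.add_sub_cancel' h.le]; exact hall k⟩
    · exact ⟨j, i - j, by omega, fun k => by rw [Nat.add_sub_cancel' h.le]; exact (hall k).symm⟩
  obtain ⟨P, hP⟩ : ∃ P, P = ⌊((i + q : ℕ) : ℝ) * α⌋ - ⌊(i : ℝ) * α⌋ := ⟨_, rfl⟩
  have hlin : ∀ r : ℕ, ⌊((i + q * r : ℕ) : ℝ) * α⌋ - ⌊(i : ℝ) * α⌋ = r * P := by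
    intro r
    induction r with
    | zero => simp
    | succ r ih =>
      have := floor_sub_floor_eq h0 h1 h0 h1 (n := q * r) (k := i) (k' := i + q) fun k _ => hper k
      rw [show i + q * (r + 1) = i + q + q * r by ring]
      push_cast at *
      linarith
  have hz : (q : ℝ) * α - P = 0 := by
    refine eq_zero_of_forall_nat_mul_lt (c := 1) fun r _ => ?_
    have := abs_floor_sub_floor_sub_lt α i (q * r)
    rw [hlin, abs_sub_comm] at this
    push_cast at this
    rwa [mul_sub, mul_left_comm, ← mul_assoc]
  have := (hα.natCast_mul hq.ne').sub_intCast P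
  rw [hz] at this
  exact this ⟨0, by simp⟩

theorem not_countable_irrational_Ioo : ¬ {α : ℝ | Irrational α ∧ 0 < α ∧ α < 1}.Countable := by
  intro h
  have : (Set.Ioo (0 : ℝ) 1).Countable := by
    refine (h.union (Set.countable_range ((↑) : ℚ → ℝ))).mono fun x hx => ?_
    by_cases hx' : Irrational x
    · exact Or.inl ⟨hx', hx.1, hx.2⟩
    · exact Or.inr (not_not.1 hx')
  rw [Cardinal.Real.Ioo_countable_iff] at this
  norm_num at this

namespace GriddedPerm

/-! ### The points of `φ(s)` -/

/-- The distance of the `i`-th point of `φ(s)` from the vertical axis. -/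
def pinReach (i : ℕ) : ℤ := if i % 2 = 0 then 2 * i + 4 else 2 * i + 1

/-- The height of the `i`-th point of `φ(s)` above the horizontal axis. -/
def pinHeight (i : ℕ) : ℤ := if i % 2 = 0 then 2 * i + 1 else 2 * i + 4

theorem fst_pinPoint (s : ℕ → Bool) (i : ℕ) : (pinPoint (pinOfBinary s) i).1 =
    if s (i / 2) = true then pinReach i else -pinReach i := by
  unfold pinPoint pinOfBinary pinReach
  by_cases h : i % 2 = 0
  · simp only [h, ↓reduceIte]
    rcases s (i / 2) <;> simp [sideDir, PinDir.vec]
  · simp only [h, ↓reduceIte]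
    rcases s (i / 2) <;> simp [sideDir, PinDir.vec]

theorem snd_pinPoint (s : ℕ → Bool) (i : ℕ) :
    (pinPoint (pinOfBinary s) i).2 = pinHeight i := by
  unfold pinPoint pinOfBinary pinHeight
  by_cases h : i % 2 = 0
  · simp only [h, ↓reduceIte]
    rcases s (i / 2) <;> simp [sideDir, PinDir.vec]
  · simp only [h, ↓reduceIte]
    rcases s (i / 2) <;> simp [sideDir, PinDir.vec]

theorem pinHeight_pos (i : ℕ) : 0 < pinHeight i := by
  unfold pinHeight; split_ifs <;> omega

theorem pinReach_pos (i : ℕ) : 0 < pinReach i := by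
  unfold pinReach; split_ifs <;> omega

theorem pinHeight_injective : Function.Injective pinHeight := by
  intro i j h
  unfold pinHeight at h
  split_ifs at h <;> omega

theorem pinReach_injective : Function.Injective pinReach := by
  intro i j h
  unfold pinReach at h
  split_ifs at h <;> omega

theorem fst_pinPoint_neg (s : ℕ → Bool) (i : ℕ) :
    (pinPoint (pinOfBinary s) i).1 < 0 ↔ s (i / 2) = false := by
  have := pinReach_pos i
  rw [fst_pinPoint]
  cases s (i / 2) <;> simp <;> omega

theorem fst_pinPoint_pos (s : ℕ → Bool) (i : ℕ) :
    0 < (pinPoint (pinOfBinary s) i).1 ↔ s (i / 2) = true := by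
  have := pinReach_pos i
  rw [fst_pinPoint]
  cases s (i / 2) <;> simp <;> omega

theorem fst_pinPoint_injective (s : ℕ → Bool) :
    Function.Injective fun i => (pinPoint (pinOfBinary s) i).1 := by
  intro i j h
  have hi := pinReach_pos i
  have hj := pinReach_pos j
  simp only [fst_pinPoint] at h
  apply pinReach_injective
  split_ifs at h <;> omega

theorem isPinSeq_pinOfBinary (s : ℕ → Bool) : IsPinSeq (pinOfBinary s) := by
  intro i
  unfold pinOfBinary
  rcases Nat.mod_two_eq_zero_or_one i with h | h
  · have h1 : (i + 1) % 2 ≠ 0 := by omega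
    have h2 : (i + 1) / 2 = i / 2 := by omega
    simp [h, h1, h2]
  · have h1 : (i + 1) % 2 = 0 := by omega
    simp [h, h1]

/-- Two points of `φ(s)` on the same side compare as their distances from the vertical axis, with
the sign of the side. -/
theorem fst_pinPoint_lt_iff (s : ℕ → Bool) (i j : ℕ) :
    (pinPoint (pinOfBinary s) i).1 < (pinPoint (pinOfBinary s) j).1 ↔
      (s (i / 2) = false ∧ s (j / 2) = true) ∨
      (s (i / 2) = true ∧ s (j / 2) = true ∧ pinReach i < pinReach j) ∨
      (s (i / 2) = false ∧ s (j / 2) = false ∧ pinReach j < pinReach i) := by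
  have hi := pinReach_pos i
  have hj := pinReach_pos j
  rw [fst_pinPoint, fst_pinPoint]
  cases s (i / 2) <;> cases s (j / 2) <;> simp <;> omega

theorem isBeyond_pinPoint_iff (s : ℕ → Bool) (i j : ℕ) :
    IsBeyond (pinPoint (pinOfBinary s) i) (pinPoint (pinOfBinary s) j) ↔
      pinHeight i < pinHeight j ∧ (s (i / 2) = s (j / 2) → pinReach i < pinReach j) := by
  have hi := pinReach_pos i
  have hj := pinReach_pos j
  have hi' := pinHeight_pos i
  have hj' := pinHeight_pos j
  unfold IsBeyond
  rw [fst_pinPoint, fst_pinPoint, snd_pinPoint, snd_pinPoint]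
  cases s (i / 2) <;> cases s (j / 2) <;> simp <;> omega

theorem isBeyond_of_add_two_le (s : ℕ → Bool) {i j : ℕ} (h : i + 2 ≤ j) :
    IsBeyond (pinPoint (pinOfBinary s) i) (pinPoint (pinOfBinary s) j) := by
  rw [isBeyond_pinPoint_iff]
  unfold pinHeight pinReach
  refine ⟨?_, fun _ => ?_⟩ <;> split_ifs <;> omega

theorem not_isBeyond_of_add_two_le (s : ℕ → Bool) {i j : ℕ} (h : i + 2 ≤ j) :
    ¬ IsBeyond (pinPoint (pinOfBinary s) j) (pinPoint (pinOfBinary s) i) := by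
  rw [isBeyond_pinPoint_iff]
  unfold pinHeight
  rintro ⟨h1, -⟩
  split_ifs at h1 <;> omega

theorem not_isBeyond_succ (s : ℕ → Bool) (i : ℕ) :
    ¬ IsBeyond (pinPoint (pinOfBinary s) i) (pinPoint (pinOfBinary s) (i + 1)) := by
  rw [isBeyond_pinPoint_iff]
  rintro ⟨h1, h2⟩
  unfold pinHeight at h1
  unfold pinReach at h2
  rcases Nat.mod_two_eq_zero_or_one i with h | h
  · have h3 : (i + 1) / 2 = i / 2 := by omega
    have h4 : (i + 1) % 2 = 1 := by omega
    have := h2 (by rw [h3])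
    simp [h, h4] at this
    omega
  · have h4 : (i + 1) % 2 = 0 := by omega
    simp [h, h4] at h1
    omega

theorem isBeyond_succ_left_iff (s : ℕ → Bool) (i : ℕ) :
    IsBeyond (pinPoint (pinOfBinary s) (i + 1)) (pinPoint (pinOfBinary s) i) ↔
      s (i / 2) ≠ s ((i + 1) / 2) := by
  rw [isBeyond_pinPoint_iff]
  rcases Nat.mod_two_eq_zero_or_one i with h | h
  · have h3 : (i + 1) / 2 = i / 2 := by omega
    have h4 : (i + 1) % 2 = 1 := by omega
    simp [pinHeight, h3, h, h4]
    omega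
  · have h4 : (i + 1) % 2 = 0 := by omega
    simp [pinHeight, pinReach, h, h4]
    constructor
    · rintro ⟨-, h5⟩ h6
      have := h5 h6.symm
      omega
    · intro h5
      exact ⟨by omega, fun h6 => absurd h6.symm h5⟩

/-- Moving all points of a pattern along the sequence by an even number of places preserves the
pattern, provided that the sides of the points agree. -/
theorem isGridMap_pinPoint_shift {ι : Type*} {p : ι → ℤ × ℤ} {s s' : ℕ → Bool} {f f' : ι → ℕ}
    (hf : IsGridMap p (pinPoint (pinOfBinary s)) f) (a b : ℕ)
    (hab : ∀ t, f t + 2 * a = f' t + 2 * b) (hs : ∀ t, s (f t / 2) = s' (f' t / 2)) :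
    IsGridMap p (pinPoint (pinOfBinary s')) f' := by
  have hR : ∀ i j, pinReach (f i) < pinReach (f j) ↔ pinReach (f' i) < pinReach (f' j) := by
    intro i j
    have := hab i
    have := hab j
    unfold pinReach
    split_ifs <;> omega
  have hH : ∀ i j, pinHeight (f i) < pinHeight (f j) ↔ pinHeight (f' i) < pinHeight (f' j) := by
    intro i j
    have := hab i
    have := hab j
    unfold pinHeight
    split_ifs <;> omega
  refine ⟨fun i j => ?_, fun i j => ?_, fun i => ⟨?_, ?_⟩, fun i => ⟨?_, ?_⟩⟩
  · rw [hf.1, fst_pinPoint_lt_iff, fst_pinPoint_lt_iff, hR, hR, hs, hs]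
  · rw [hf.2.1, snd_pinPoint, snd_pinPoint, snd_pinPoint, snd_pinPoint, hH]
  · rw [(hf.2.2.1 i).1, fst_pinPoint_neg, fst_pinPoint_neg, hs]
  · rw [(hf.2.2.1 i).2, fst_pinPoint_pos, fst_pinPoint_pos, hs]
  · have := pinHeight_pos (f i)
    have := pinHeight_pos (f' i)
    rw [(hf.2.2.2 i).1, snd_pinPoint, snd_pinPoint]
    omega
  · have := pinHeight_pos (f i)
    have := pinHeight_pos (f' i)
    rw [(hf.2.2.2 i).2, snd_pinPoint, snd_pinPoint]
    omega

/-! ### The class of `φ(s)` is box closed -/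

theorem mem_pinClass_iff {w : ℕ → PinLetter} {π : GriddedPerm} :
    π ∈ pinClass w ↔ ∃ f, IsGridMap π.point (pinPoint w) f :=
  containedIn_iff π _

theorem mem_pinClass_of_boxSum_mem {w : ℕ → PinLetter} (σ τ : GriddedPerm)
    (h : σ.boxSum τ ∈ pinClass w) : σ ∈ pinClass w ∧ τ ∈ pinClass w := by
  simp only [mem_pinClass_iff] at *
  obtain ⟨f, hf⟩ := h
  exact ⟨⟨_, hf.comp (isGridMap_boxInl σ τ)⟩, ⟨_, hf.comp (isGridMap_boxInr σ τ)⟩⟩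

theorem empty_mem_pinClass (w : ℕ → PinLetter) : empty ∈ pinClass w := by
  have : IsEmpty (Fin empty.size) := inferInstanceAs (IsEmpty (Fin 0))
  exact mem_pinClass_iff.2 ⟨isEmptyElim, fun i => isEmptyElim i, fun i => isEmptyElim i,
    fun i => isEmptyElim i, fun i => isEmptyElim i⟩

theorem snd_point_pos_of_mem {s : ℕ → Bool} (π : GriddedPerm)
    (h : π ∈ pinClass (pinOfBinary s)) (i : Fin π.size) : 0 < (π.point i).2 := by
  obtain ⟨f, hf⟩ := mem_pinClass_iff.1 h
  rw [(hf.2.2.2 i).2, snd_pinPoint]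
  exact pinHeight_pos _

theorem exists_forall_lt_of_fin {n : ℕ} (f : Fin n → ℕ) : ∃ N, ∀ i, f i < N := by
  obtain ⟨N, hN⟩ := (Set.finite_range f).bddAbove
  exact ⟨N + 1, fun i => Nat.lt_succ_of_le (hN ⟨i, rfl⟩)⟩

/-- Since every factor of `s` recurs, the outer summand can be moved far beyond the inner one. -/
theorem isBoxClosed_pinClass {s : ℕ → Bool} (hs : IsSturmian s) :
    IsBoxClosed (pinClass (pinOfBinary s)) := by
  intro σ hσ τ hτ
  obtain ⟨f, hf⟩ := mem_pinClass_iff.1 hσ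
  obtain ⟨g, hg⟩ := mem_pinClass_iff.1 hτ
  obtain ⟨M, hM⟩ := exists_forall_lt_of_fin f
  obtain ⟨N, hN⟩ := exists_forall_lt_of_fin g
  obtain ⟨k, hk, hkN⟩ := hs.exists_ge_forall_eq N 0 (M + 1)
  have hg' : IsGridMap τ.point (pinPoint (pinOfBinary s)) fun j => g j + 2 * k := by
    refine isGridMap_pinPoint_shift hg k 0 (fun _ => rfl) fun j => ?_
    have h1 := hkN (g j / 2) (by have := hN j; omega)
    rw [show (g j + 2 * k) / 2 = k + g j / 2 by omega, h1, zero_add]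
  obtain ⟨h, hh, -⟩ := exists_isGridMap_boxSum hf hg'
    fun i j => isBeyond_of_add_two_le s (by have := hM i; omega)
  exact mem_pinClass_iff.2 ⟨h, hh⟩

/-! ### Runs of consecutive points -/

/-- The gridded permutation `π` is the pattern of the `n` consecutive points of `φ(s)` that start
with the `i`-th one. -/
def IsRun (s : ℕ → Bool) (i n : ℕ) (π : GriddedPerm) : Prop :=
  ∃ f : Fin π.size → ℕ, IsGridMap π.point (pinPoint (pinOfBinary s)) f ∧
    Set.range f = Set.Ico i (i + n)

variable {s s' : ℕ → Bool} {i j n : ℕ} {π π' : GriddedPerm}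

theorem IsRun.size_eq (h : IsRun s i n π) : π.size = n := by
  obtain ⟨f, hf, hr⟩ := h
  have hinj := hf.injective π.point_fst_injective
  have := Set.ncard_image_of_injective Set.univ hinj
  rw [Set.image_univ, hr, Set.ncard_univ, Nat.card_eq_fintype_card, Fintype.card_fin,
    ← Finset.coe_Ico, Set.ncard_coe_finset, Nat.card_Ico] at this
  omega

theorem IsRun.mem_pinClass (h : IsRun s i n π) : π ∈ pinClass (pinOfBinary s) := by
  obtain ⟨f, hf, -⟩ := h
  exact mem_pinClass_iff.2 ⟨f, hf⟩

theorem IsRun.eq (h : IsRun s i n π) (h' : IsRun s i n π') : π = π' := by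
  obtain ⟨f, hf, hr⟩ := h
  obtain ⟨f', hf', hr'⟩ := h'
  exact eq_of_range_eq hf hf' (hr.trans hr'.symm)

theorem exists_isRun (s : ℕ → Bool) (i n : ℕ) : ∃ π, IsRun s i n π := by
  let q : Fin n → ℤ × ℤ := pinPoint (pinOfBinary s) ∘ fun t => i + t
  have hinj : Function.Injective fun t : Fin n => i + (t : ℕ) := fun a b h => by
    apply Fin.ext
    simp only at h
    omega
  obtain ⟨π, f, hf, hb⟩ := exists_isGridMap_bijective q
    ((fst_pinPoint_injective s).comp hinj)
    (fun a b h => by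
      simp only [q, Function.comp, snd_pinPoint] at h
      exact hinj (pinHeight_injective h))
    (fun t h => by
      have h1 := fst_pinPoint_neg s (i + t)
      have h2 := fst_pinPoint_pos s (i + t)
      have h3 : (pinPoint (pinOfBinary s) (i + t)).1 = 0 := h
      rw [h3] at h1 h2
      cases hs : s ((i + t) / 2) <;> simp [hs] at h1 h2)
    (fun t h => by
      have h3 : (pinPoint (pinOfBinary s) (i + t)).2 = 0 := h
      have := pinHeight_pos (i + t)
      rw [snd_pinPoint] at h3
      omega)
  refine ⟨π, _, (isGridMap_comp_right _ _).comp hf, ?_⟩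
  rw [Set.range_comp, hb.2.range_eq, Set.image_univ]
  ext k
  constructor
  · rintro ⟨t, rfl⟩
    have := t.2
    simp only [Set.mem_Ico]
    omega
  · rintro ⟨h1, h2⟩
    refine ⟨⟨k - i, by omega⟩, ?_⟩
    simp only
    omega

/-- The pattern of the `n` consecutive points of `φ(s)` that start with the `i`-th one. -/
noncomputable def runPattern (s : ℕ → Bool) (n i : ℕ) : GriddedPerm := (exists_isRun s i n).choose

theorem isRun_runPattern (s : ℕ → Bool) (n i : ℕ) : IsRun s i n (runPattern s n i) :=
  (exists_isRun s i n).choose_spec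

theorem IsRun.runPattern_eq (h : IsRun s i n π) : runPattern s n i = π :=
  (isRun_runPattern s n i).eq h

/-- Runs whose places have the same parity and whose points are on the same sides have the same
pattern. -/
theorem IsRun.shift (h : IsRun s i n π) (hij : i % 2 = j % 2)
    (hs : ∀ t < n, s ((i + t) / 2) = s' ((j + t) / 2)) : IsRun s' j n π := by
  obtain ⟨f, hf, hr⟩ := h
  have hmem : ∀ k, i ≤ f k ∧ f k < i + n := fun k => by
    have : f k ∈ Set.Ico i (i + n) := hr ▸ Set.mem_range_self k
    exact this
  refine ⟨fun k => f k - i + j, isGridMap_pinPoint_shift hf j ((i + j) / 2) (fun k => ?_)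
    fun k => ?_, ?_⟩
  · have := hmem k
    omega
  · have h1 := hmem k
    have := hs (f k - i) (by omega)
    rw [Nat.add_sub_cancel' h1.1] at this
    rw [this, add_comm j]
  · ext k
    constructor
    · rintro ⟨t, rfl⟩
      have := hmem t
      simp only [Set.mem_Ico]
      omega
    · rintro ⟨h1, h2⟩
      have : k - j + i ∈ Set.range f := by rw [hr]; constructor <;> omega
      obtain ⟨t, ht⟩ := this
      exact ⟨t, by simp only; omega⟩

/-- Transport of a pattern from one run to another along a map of places. -/
theorem IsRun.map (h : IsRun s i n π) (e : ℕ → ℕ)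
    (he : ∀ a, i ≤ a → a < i + n → j ≤ e a ∧ e a < j + n)
    (hsurj : ∀ b, j ≤ b → b < j + n → ∃ a, i ≤ a ∧ a < i + n ∧ e a = b)
    (hs : ∀ a, i ≤ a → a < i + n → s (a / 2) = s' (e a / 2))
    (hR : ∀ a b, i ≤ a → a < i + n → i ≤ b → b < i + n → s (a / 2) = s (b / 2) →
      (pinReach a < pinReach b ↔ pinReach (e a) < pinReach (e b)))
    (hH : ∀ a b, i ≤ a → a < i + n → i ≤ b → b < i + n →
      (pinHeight a < pinHeight b ↔ pinHeight (e a) < pinHeight (e b))) :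
    IsRun s' j n π := by
  obtain ⟨f, hf, hr⟩ := h
  have hmem : ∀ k, i ≤ f k ∧ f k < i + n := fun k => by
    have : f k ∈ Set.Ico i (i + n) := hr ▸ Set.mem_range_self k
    exact this
  refine ⟨e ∘ f, ⟨fun a b => ?_, fun a b => ?_, fun a => ⟨?_, ?_⟩, fun a => ⟨?_, ?_⟩⟩, ?_⟩
  · obtain ⟨h1, h2⟩ := hmem a
    obtain ⟨h3, h4⟩ := hmem b
    have r1 := hR _ _ h1 h2 h3 h4
    have r2 := hR _ _ h3 h4 h1 h2
    rw [hf.1, fst_pinPoint_lt_iff, fst_pinPoint_lt_iff, Function.comp, Function.comp,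
      ← hs _ h1 h2, ← hs _ h3 h4]
    cases ha : s (f a / 2) <;> cases hb : s (f b / 2) <;> simp [ha, hb] at r1 r2 ⊢
    · exact r2
    · exact r1
  · obtain ⟨h1, h2⟩ := hmem a
    obtain ⟨h3, h4⟩ := hmem b
    rw [hf.2.1, snd_pinPoint, snd_pinPoint, snd_pinPoint, snd_pinPoint]
    exact hH _ _ h1 h2 h3 h4
  · rw [(hf.2.2.1 a).1, fst_pinPoint_neg, fst_pinPoint_neg, Function.comp,
      hs _ (hmem a).1 (hmem a).2]
  · rw [(hf.2.2.1 a).2, fst_pinPoint_pos, fst_pinPoint_pos, Function.comp,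
      hs _ (hmem a).1 (hmem a).2]
  · have := pinHeight_pos (f a)
    have := pinHeight_pos ((e ∘ f) a)
    rw [(hf.2.2.2 a).1, snd_pinPoint, snd_pinPoint]
    omega
  · have := pinHeight_pos (f a)
    have := pinHeight_pos ((e ∘ f) a)
    rw [(hf.2.2.2 a).2, snd_pinPoint, snd_pinPoint]
    omega
  · rw [Set.range_comp, hr]
    ext b
    constructor
    · rintro ⟨a, ha, rfl⟩
      exact he a ha.1 ha.2
    · rintro ⟨h1, h2⟩
      obtain ⟨a, h3, h4, rfl⟩ := hsurj b h1 h2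
      exact ⟨a, ⟨h3, h4⟩, rfl⟩

/-! ### The box indecomposable members of the class of `φ(s)` -/

/-- A gap in a set of places separates the points before it from the points after it, so box
indecomposables are patterns of runs. -/
theorem exists_isRun_of_isBoxIndecomposable (hπ : π ∈ pinClass (pinOfBinary s))
    (hi : π.IsBoxIndecomposable) : ∃ i, IsRun s i π.size π := by
  obtain ⟨f, hf⟩ := mem_pinClass_iff.1 hπ
  obtain ⟨h0, h⟩ := (isBoxIndecomposable_iff_of_isGridMap hf).1 hi
  have hconn : ∀ a ∈ Set.range f, ∀ b ∈ Set.range f, ∀ c, a < c → c < b → c ∈ Set.range f := by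
    intro a ha b hb c hac hcb
    by_contra hc
    have := h {t | t ∈ Set.range f ∧ t < c} (fun t ht => ht.1) ⟨a, ha, hac⟩ (by
      rintro t ⟨-, ht⟩ u hu hut
      have hu1 : ¬ u < c := fun hlt => hut ⟨hu, hlt⟩
      have hu2 : u ≠ c := fun h => hc (h ▸ hu)
      exact isBeyond_of_add_two_le s (by omega))
    rw [← this] at hb
    have := hb.2
    omega
  have hne : (Finset.univ.image f).Nonempty := ⟨f ⟨0, h0⟩, by simp⟩
  have hS : ∀ t, t ∈ Finset.univ.image f ↔ t ∈ Set.range f := fun t => by simp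
  obtain ⟨i, hi⟩ : ∃ i, i = (Finset.univ.image f).min' hne := ⟨_, rfl⟩
  obtain ⟨m, hm⟩ : ∃ m, m = (Finset.univ.image f).max' hne := ⟨_, rfl⟩
  have hi1 : i ∈ Set.range f := (hS i).1 (hi ▸ Finset.min'_mem _ _)
  have hm1 : m ∈ Set.range f := (hS m).1 (hm ▸ Finset.max'_mem _ _)
  have heq : Finset.univ.image f = Finset.Icc i m := by
    ext t
    rw [Finset.mem_Icc]
    refine ⟨fun ht => ⟨hi ▸ Finset.min'_le _ _ ht, hm ▸ Finset.le_max' _ _ ht⟩, fun ht => ?_⟩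
    rw [hS]
    rcases eq_or_lt_of_le ht.1 with rfl | h1
    · exact hi1
    · rcases eq_or_lt_of_le ht.2 with rfl | h2
      · exact hm1
      · exact hconn i hi1 m hm1 t h1 h2
  have hcard := Finset.card_image_of_injective Finset.univ (hf.injective π.point_fst_injective)
  rw [heq, Nat.card_Icc, Finset.card_univ, Fintype.card_fin] at hcard
  refine ⟨i, f, hf, ?_⟩
  ext t
  rw [← hS, heq, Finset.mem_Icc, Set.mem_Ico]
  omega

/-- The point at each place is not beyond its predecessor, and a point is never beyond those at
least two places later; so a box that contains a point of a run of length at least three contains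
the last point, hence the first, hence all. -/
theorem IsRun.isBoxIndecomposable (h : IsRun s i n π) (hn : 0 < n)
    (hn2 : n = 2 → s (i / 2) = s ((i + 1) / 2)) : π.IsBoxIndecomposable := by
  have hsize := h.size_eq
  obtain ⟨f, hf, hr⟩ := h
  rw [isBoxIndecomposable_iff_of_isGridMap hf, hr]
  refine ⟨by omega, fun A hA hne hb => hA.antisymm ?_⟩
  have hstep : ∀ t ∈ A, t + 1 < i + n → t + 1 ∈ A := by
    intro t ht ht1
    by_contra hcon
    have := hA ht
    exact not_isBeyond_succ s t (hb t ht (t + 1) ⟨by have := this.1; omega, ht1⟩ hcon)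
  have hup : ∀ d t, t ∈ A → t + d < i + n → t + d ∈ A := by
    intro d
    induction d with
    | zero => exact fun t ht _ => ht
    | succ d ih => exact fun t ht hd => hstep _ (ih t ht (by omega)) hd
  have hfirst : i ∈ A := by
    obtain ⟨t, ht⟩ := hne
    have h1 := hA ht
    have hlast : i + (n - 1) ∈ A := by
      have := hup (i + (n - 1) - t) t ht (by have := h1.1; have := h1.2; omega)
      rwa [show t + (i + (n - 1) - t) = i + (n - 1) by have := h1.1; have := h1.2; omega] at this
    by_contra hcon
    have hbi := hb _ hlast i ⟨le_rfl, by omega⟩ hcon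
    obtain rfl | rfl | hn3 : n = 1 ∨ n = 2 ∨ 3 ≤ n := by omega
    · exact hcon hlast
    · exact (isBeyond_succ_left_iff s i).1 hbi (hn2 rfl)
    · exact not_isBeyond_of_add_two_le s (by omega) hbi
  rintro t ⟨h1, h2⟩
  have := hup (t - i) i hfirst (by omega)
  rwa [Nat.add_sub_cancel' h1] at this

/-- A box indecomposable run of length two has both points on the same side. -/
theorem IsRun.side_eq_of_isBoxIndecomposable (h : IsRun s i 2 π) (hπ : π.IsBoxIndecomposable) :
    s (i / 2) = s ((i + 1) / 2) := by
  obtain ⟨f, hf, hr⟩ := h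
  rw [isBoxIndecomposable_iff_of_isGridMap hf, hr] at hπ
  by_contra hne
  have := hπ.2 {i + 1} (by rintro _ rfl; constructor <;> omega) ⟨i + 1, rfl⟩ (by
    rintro _ rfl b ⟨h1, h2⟩ hb
    rw [Set.mem_singleton_iff] at hb
    obtain rfl : b = i := by omega
    exact (isBeyond_succ_left_iff s b).2 hne)
  have h2 : i ∈ ({i + 1} : Set ℕ) := this ▸ ⟨le_rfl, by omega⟩
  rw [Set.mem_singleton_iff] at h2
  omega

/-! ### Reading a run off its pattern -/

/-- The order by height identifies the points of runs at places of the same parity, so the pattern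
determines their sides. -/
theorem IsRun.side_eq (h : IsRun s i n π) (h' : IsRun s' j n π) (hij : i % 2 = j % 2) :
    ∀ t < n, s ((i + t) / 2) = s' ((j + t) / 2) := by
  obtain ⟨f, hf, hr⟩ := h
  obtain ⟨f', hf', hr'⟩ := h'
  have key : ∀ (s : ℕ → Bool) (f : Fin π.size → ℕ) (c : ℕ), c % 2 = 0 →
      IsGridMap π.point (pinPoint (pinOfBinary s)) f →
      StrictMono fun k => pinHeight (f (π.perm.symm k) + c) := by
    intro s f c hc hf k l hkl
    have := (hf.2.1 (π.perm.symm k) (π.perm.symm l))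
    rw [point_snd_lt, snd_pinPoint, snd_pinPoint, Equiv.apply_symm_apply,
      Equiv.apply_symm_apply] at this
    have := this.1 hkl
    unfold pinHeight at *
    simp only
    split_ifs at * <;> omega
  have hrange : ∀ (f : Fin π.size → ℕ) (i c : ℕ), Set.range f = Set.Ico i (i + n) →
      Set.range (fun k => pinHeight (f (π.perm.symm k) + c)) =
        pinHeight '' Set.Ico (i + c) (i + c + n) := by
    intro f i c hr
    rw [Set.range_comp' (fun t => pinHeight (t + c)), Set.range_comp' f, π.perm.symm.range_eq_univ,
      Set.image_univ, hr]
    ext x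
    constructor
    · rintro ⟨t, ⟨h1, h2⟩, rfl⟩
      exact ⟨t + c, ⟨by omega, by omega⟩, rfl⟩
    · rintro ⟨t, ⟨h1, h2⟩, rfl⟩
      exact ⟨t - c, ⟨by omega, by omega⟩, by simp only; congr 1; omega⟩
  have h1 := key s f (2 * j) (by omega) hf
  have h2 := key s' f' (i + j) (by omega) hf'
  have h3 := (StrictMono.range_inj h1 h2).1 (by
    rw [hrange f i _ hr, hrange f' j _ hr', show j + (i + j) = i + 2 * j by ring])
  intro t ht
  have hmem : i + t ∈ Set.range f := by rw [hr]; constructor <;> omega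
  obtain ⟨k, hk⟩ := hmem
  have h4 := pinHeight_injective (congrFun h3 (π.perm k))
  rw [Equiv.symm_apply_apply, hk] at h4
  have hk' : f' k = j + t := by omega
  have h5 := (hf.2.2.1 k).2
  have h6 := (hf'.2.2.1 k).2
  rw [fst_pinPoint_pos, hk] at h5
  rw [fst_pinPoint_pos, hk'] at h6
  rw [Bool.eq_iff_iff, ← h5, h6]

/-- In a run that starts at an even place `i`, the two lowest points are those at `i` and `i + 2`; in
a run that starts at an odd place `j`, they are those at `j + 1` and `j`. -/
theorem exists_two_lowest {f f' : Fin π.size → ℕ}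
    (hf : IsGridMap π.point (pinPoint (pinOfBinary s)) f) (hr : Set.range f = Set.Ico i (i + n))
    (hf' : IsGridMap π.point (pinPoint (pinOfBinary s')) f')
    (hr' : Set.range f' = Set.Ico j (j + n)) (hi : i % 2 = 0) (hj : j % 2 = 1) (hn : 3 ≤ n) :
    ∃ a b, f a = i ∧ f' a = j + 1 ∧ f b = i + 2 ∧ f' b = j := by
  have hlt : ∀ k l, pinHeight (f k) < pinHeight (f l) ↔ pinHeight (f' k) < pinHeight (f' l) := by
    intro k l
    rw [← snd_pinPoint s, ← snd_pinPoint s, ← hf.2.1, hf'.2.1, snd_pinPoint, snd_pinPoint]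
  have hmem : ∀ k, i ≤ f k ∧ f k < i + n := fun k => by
    have : f k ∈ Set.Ico i (i + n) := hr ▸ Set.mem_range_self k
    exact this
  have hmem' : ∀ k, j ≤ f' k ∧ f' k < j + n := fun k => by
    have : f' k ∈ Set.Ico j (j + n) := hr' ▸ Set.mem_range_self k
    exact this
  have hex : ∀ t < n, ∃ k, f k = i + t := fun t ht => by
    have : i + t ∈ Set.range f := by rw [hr]; constructor <;> omega
    exact this
  have hex' : ∀ t < n, ∃ k, f' k = j + t := fun t ht => by
    have : j + t ∈ Set.range f' := by rw [hr']; constructor <;> omega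
    exact this
  obtain ⟨a, ha⟩ := hex 0 (by omega)
  obtain ⟨b, hb⟩ := hex 2 (by omega)
  obtain ⟨a', ha'⟩ := hex' 1 (by omega)
  obtain ⟨b', hb'⟩ := hex' 0 (by omega)
  have e1 : a = a' := by
    by_contra hne
    have h1 : f a ≠ f a' := fun h => hne (hf.injective π.point_fst_injective h)
    have h2 := (hlt a a').1 (by
      have := hmem a'
      unfold pinHeight
      split_ifs <;> omega)
    have := hmem' a
    unfold pinHeight at h2
    split_ifs at h2 <;> omega
  have e2 : b = b' := by
    by_contra hne
    have h1 : f b ≠ f b' := fun h => hne (hf.injective π.point_fst_injective h)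
    have h3 : f a ≠ f b' := fun h => by
      have := hf.injective π.point_fst_injective h
      rw [e1] at this
      rw [this] at ha'
      omega
    have h4 : f' a ≠ f' b := fun h => by
      have := hf'.injective π.point_fst_injective h
      rw [this] at ha
      omega
    have h2 := (hlt b b').1 (by
      have := hmem b'
      unfold pinHeight
      split_ifs <;> omega)
    have := hmem' b
    rw [e1] at h4
    unfold pinHeight at h2
    split_ifs at h2 <;> omega
  exact ⟨a, b, ha, e1 ▸ ha', hb, by rw [e2]; exact hb'⟩

/-- In a run of at least four points that starts at an even place, the third lowest point is on the
side of the lowest one and closer to the axis; in a run that starts at an odd place it is not. -/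
theorem IsRun.parity_eq (h : IsRun s i n π) (h' : IsRun s' j n π) (hi : i % 2 = 0) (hn : 4 ≤ n) :
    j % 2 = 0 := by
  by_contra hj
  obtain ⟨f, hf, hr⟩ := h
  obtain ⟨f', hf', hr'⟩ := h'
  obtain ⟨a, b, ha, ha', hb, hb'⟩ := exists_two_lowest hf hr hf' hr' hi (by omega) (by omega)
  have hmem : ∀ k, i ≤ f k ∧ f k < i + n := fun k => by
    have : f k ∈ Set.Ico i (i + n) := hr ▸ Set.mem_range_self k
    exact this
  have hmem' : ∀ k, j ≤ f' k ∧ f' k < j + n := fun k => by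
    have : f' k ∈ Set.Ico j (j + n) := hr' ▸ Set.mem_range_self k
    exact this
  have hinj := hf.injective π.point_fst_injective
  have hinj' := hf'.injective π.point_fst_injective
  obtain ⟨c, hc⟩ : i + 1 ∈ Set.range f := by rw [hr]; constructor <;> omega
  obtain ⟨c', hc'⟩ : j + 3 ∈ Set.range f' := by rw [hr']; constructor <;> omega
  have e : c = c' := by
    by_contra hne
    have h1 : f c ≠ f c' := fun h => hne (hinj h)
    have h2 : f a ≠ f c' := fun h => by
      rw [hinj h] at ha'
      omega
    have h3 : f b ≠ f c' := fun h => by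
      rw [hinj h] at hb'
      omega
    have h4 : f' a ≠ f' c := fun h => by
      rw [hinj' h] at ha
      omega
    have h5 : f' b ≠ f' c := fun h => by
      rw [hinj' h] at hb
      omega
    have h6 := (hf.2.1 c c').symm.trans (hf'.2.1 c c')
    rw [snd_pinPoint, snd_pinPoint, snd_pinPoint, snd_pinPoint] at h6
    have h7 := h6.1 (by
      have := hmem c'
      unfold pinHeight
      split_ifs <;> omega)
    have := hmem' c
    unfold pinHeight at h7
    split_ifs at h7 <;> omega
  rw [← e] at hc'
  have hb1 := (hf.isBeyond_iff a c).symm.trans (hf'.isBeyond_iff a c)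
  rw [ha, hc, ha', hc'] at hb1
  exact not_isBeyond_succ s i (hb1.2 (isBeyond_of_add_two_le s' (by omega)))

/-- A run of three points on one side shows the parity of its place too. -/
theorem IsRun.parity_eq_of_side_eq (h : IsRun s i 3 π) (h' : IsRun s' j 3 π) (hi : i % 2 = 0)
    (hs : s' (j / 2) = s' ((j + 1) / 2)) : j % 2 = 0 := by
  by_contra hj
  obtain ⟨f, hf, hr⟩ := h
  obtain ⟨f', hf', hr'⟩ := h'
  obtain ⟨a, b, ha, ha', hb, hb'⟩ := exists_two_lowest hf hr hf' hr' hi (by omega) le_rfl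
  have hb1 := (hf.isBeyond_iff a b).symm.trans (hf'.isBeyond_iff a b)
  rw [ha, hb, ha', hb'] at hb1
  exact (isBeyond_succ_left_iff s' j).1 (hb1.1 (isBeyond_of_add_two_le s le_rfl)) hs

/-- A run of three points at an odd place, with its points on both sides, has the pattern of a run
at an even place. -/
theorem IsRun.of_odd_of_side_ne {k l : ℕ} (h : IsRun s (2 * k + 1) 3 π) (hs : s k ≠ s (k + 1))
    (h0 : s l = s (k + 1)) (h1 : s (l + 1) = s k) : IsRun s (2 * l) 3 π := by
  -- the places in increasing order of height are `2 k + 2`, `2 k + 1`, `2 k + 3` and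
  -- `2 l`, `2 l + 2`, `2 l + 1`
  obtain ⟨e, e1, e2, e3⟩ : ∃ e : ℕ → ℕ, e (2 * k + 1) = 2 * l + 2 ∧ e (2 * k + 2) = 2 * l ∧
      e (2 * k + 3) = 2 * l + 1 :=
    ⟨fun a => if a = 2 * k + 1 then 2 * l + 2 else if a = 2 * k + 2 then 2 * l else 2 * l + 1,
      by simp, by simp, by simp⟩
  have hcases : ∀ a, 2 * k + 1 ≤ a → a < 2 * k + 1 + 3 →
      a = 2 * k + 1 ∨ a = 2 * k + 2 ∨ a = 2 * k + 3 := fun a ha ha' => by omega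
  have hs1 : s ((2 * k + 1) / 2) = s k := by congr 1; omega
  have hs2 : s ((2 * k + 2) / 2) = s (k + 1) := by congr 1; omega
  have hs3 : s ((2 * k + 3) / 2) = s (k + 1) := by congr 1; omega
  have heven : ∀ m, pinReach (2 * m) = 4 * m + 4 ∧ pinHeight (2 * m) = 4 * m + 1 := fun m => by
    constructor
    · unfold pinReach; split_ifs <;> omega
    · unfold pinHeight; split_ifs <;> omega
  have hodd : ∀ m, pinReach (2 * m + 1) = 4 * m + 3 ∧ pinHeight (2 * m + 1) = 4 * m + 6 :=
    fun m => by
      constructor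
      · unfold pinReach; split_ifs <;> omega
      · unfold pinHeight; split_ifs <;> omega
  have k1 := hodd k
  have k2 := heven (k + 1)
  have k3 := hodd (k + 1)
  have l1 := heven l
  have l2 := hodd l
  have l3 := heven (l + 1)
  rw [show 2 * (k + 1) = 2 * k + 2 by ring] at k2 k3
  rw [show 2 * (l + 1) = 2 * l + 2 by ring] at l3
  rw [show 2 * k + 2 + 1 = 2 * k + 3 by ring] at k3
  refine h.map e (fun a ha ha' => ?_) (fun b hb hb' => ?_)
    (fun a ha ha' => ?_) (fun a b ha ha' hb hb' hab => ?_) (fun a b ha ha' hb hb' => ?_)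
  · rcases hcases a ha ha' with rfl | rfl | rfl <;> omega
  · obtain rfl | rfl | rfl : b = 2 * l ∨ b = 2 * l + 1 ∨ b = 2 * l + 2 := by omega
    · exact ⟨2 * k + 2, by omega, by omega, e2⟩
    · exact ⟨2 * k + 3, by omega, by omega, e3⟩
    · exact ⟨2 * k + 1, by omega, by omega, e1⟩
  · rcases hcases a ha ha' with rfl | rfl | rfl
    · rw [hs1, e1, show (2 * l + 2) / 2 = l + 1 by omega, h1]
    · rw [hs2, e2, show 2 * l / 2 = l by omega, h0]
    · rw [hs3, e3, show (2 * l + 1) / 2 = l by omega, h0]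
  · rcases hcases a ha ha' with rfl | rfl | rfl <;> rcases hcases b hb hb' with rfl | rfl | rfl
    · simp
    · rw [hs1, hs2] at hab
      exact absurd hab hs
    · rw [hs1, hs3] at hab
      exact absurd hab hs
    · rw [hs1, hs2] at hab
      exact absurd hab.symm hs
    · simp
    · rw [e2, e3, k2.1, k3.1, l1.1, l2.1]
      omega
    · rw [hs1, hs3] at hab
      exact absurd hab.symm hs
    · rw [e2, e3, k2.1, k3.1, l1.1, l2.1]
      omega
    · simp
  · rcases hcases a ha ha' with rfl | rfl | rfl <;> rcases hcases b hb hb' with rfl | rfl | rfl <;>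
      simp only [e1, e2, e3, k1.2, k2.2, k3.2, l1.2, l2.2, l3.2] <;> omega

theorem IsRun.two_of_odd {k : ℕ} (h : IsRun s (2 * k + 1) 2 π) (hs : s k = s (k + 1)) :
    IsRun s (2 * k) 2 π := by
  refine h.map (fun a => if a = 2 * k + 1 then 2 * k + 1 else 2 * k)
    (fun a ha ha' => by split_ifs <;> omega) (fun b hb hb' => ?_)
    (fun a ha ha' => ?_) (fun a b ha ha' hb hb' hab => ?_) (fun a b ha ha' hb hb' => ?_)
  · obtain rfl | rfl : b = 2 * k ∨ b = 2 * k + 1 := by omega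
    · exact ⟨2 * k + 2, by omega, by omega, by simp⟩
    · exact ⟨2 * k + 1, by omega, by omega, by simp⟩
  · obtain rfl | rfl : a = 2 * k + 1 ∨ a = 2 * k + 2 := by omega
    · rw [if_pos rfl]
    · rw [if_neg (by omega), show (2 * k + 2) / 2 = k + 1 by omega, show 2 * k / 2 = k by omega, hs]
  · unfold pinReach
    split_ifs <;> omega
  · unfold pinHeight
    split_ifs <;> omega

theorem IsRun.one_of_odd {k : ℕ} (h : IsRun s (2 * k + 1) 1 π) : IsRun s (2 * k) 1 π := by
  refine h.map (fun _ => 2 * k) (fun a ha ha' => by omega)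
    (fun b hb hb' => ⟨2 * k + 1, by omega, by omega, by omega⟩)
    (fun a ha ha' => ?_) (fun a b ha ha' hb hb' hab => ?_) (fun a b ha ha' hb hb' => ?_)
  · obtain rfl : a = 2 * k + 1 := by omega
    congr 1
    omega
  · obtain rfl : a = b := by omega
    simp
  · obtain rfl : a = b := by omega
    simp

end GriddedPerm

/-! ### Short factors of a Sturmian word -/

namespace IsSturmian

variable {s : ℕ → Bool}

/-- Together with `ab`, the factor `ba` occurs too. -/
theorem exists_swap (hs : IsSturmian s) {k : ℕ} (h : s k ≠ s (k + 1)) :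
    ∃ l, s l = s (k + 1) ∧ s (l + 1) = s k := by
  have hex : ∃ m, s (k + 1 + m) = s k := by
    obtain ⟨k', hk', he⟩ := hs.exists_ge_forall_eq 1 k (k + 1)
    exact ⟨k' - (k + 1), by rw [Nat.add_sub_cancel' hk']; exact he 0 one_pos⟩
  classical
  obtain ⟨m, hm⟩ : ∃ m, m = Nat.find hex := ⟨_, rfl⟩
  have h1 : s (k + 1 + m) = s k := hm ▸ Nat.find_spec hex
  rcases m with _ | m
  · exact absurd h1.symm h
  · refine ⟨k + 1 + m, ?_, h1⟩
    have h2 : s (k + 1 + m) ≠ s k := Nat.find_min hex (by omega)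
    revert h h2
    cases s (k + 1 + m) <;> cases s k <;> cases s (k + 1) <;> simp

/-- Exactly one of the factors `00` and `11` occurs. -/
theorem exists_unique_square (hs : IsSturmian s) :
    ∃ k, s k = s (k + 1) ∧ ∀ l, s l = s (l + 1) → s l = s k := by
  have hcard : (Set.range (factorAt s 2))ᶜ.ncard = 1 := by
    have h1 := hs 2
    rw [factorComplexity_eq] at h1
    have h2 := Set.ncard_add_ncard_compl (Set.range (factorAt s 2))
    rw [h1] at h2
    simp at h2
    omega
  obtain ⟨u, hu⟩ := Set.ncard_eq_one.1 hcard
  have hmem : ∀ v, v ≠ u → ∃ k, s k = v 0 ∧ s (k + 1) = v 1 := by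
    intro v hv
    have : v ∈ Set.range (factorAt s 2) := by
      by_contra hcon
      have h1 : v ∈ ({u} : Set (Fin 2 → Bool)) := hu ▸ hcon
      exact hv h1
    obtain ⟨k, rfl⟩ := this
    exact ⟨k, rfl, rfl⟩
  have hnot : ∀ k, ¬ (s k = u 0 ∧ s (k + 1) = u 1) := by
    rintro k ⟨h0, h1⟩
    have h2 : u ∈ (Set.range (factorAt s 2))ᶜ := hu ▸ Set.mem_singleton u
    refine h2 ⟨k, funext fun t => ?_⟩
    fin_cases t
    · exact h0
    · exact h1
  have heq : u 0 = u 1 := by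
    by_contra hne
    obtain ⟨k, h0, h1⟩ := hmem ![u 1, u 0] fun h => hne (congrFun h 1)
    simp at h0 h1
    obtain ⟨l, h2, h3⟩ := hs.exists_swap (k := k) (by rw [h0, h1]; exact Ne.symm hne)
    exact hnot l ⟨h2.trans h1, h3.trans h0⟩
  obtain ⟨k, h0, h1⟩ := hmem (fun _ => !u 0) fun h => by
    have := congrFun h 0
    simp at this
  refine ⟨k, h0.trans h1.symm, fun l hl => ?_⟩
  have := hnot l
  rw [← hl, ← heq, and_self] at this
  rw [h0]
  revert this
  cases s l <;> cases u 0 <;> simp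

end IsSturmian

namespace GriddedPerm

/-! ### Counting the box indecomposables -/

variable {s : ℕ → Bool} {n : ℕ}

theorem runPattern_eq_iff (s : ℕ → Bool) (n i j : ℕ) (hij : i % 2 = j % 2) :
    runPattern s n i = runPattern s n j ↔ ∀ t < n, s ((i + t) / 2) = s ((j + t) / 2) := by
  refine ⟨fun h => (isRun_runPattern s n i).side_eq (h ▸ isRun_runPattern s n j) hij, fun h => ?_⟩
  exact (((isRun_runPattern s n i).shift hij h).runPattern_eq).symm

/-- The `n` points from an even place on are governed by a factor of length `⌈n / 2⌉`. -/
theorem ncard_range_runPattern_even (s : ℕ → Bool) (n : ℕ) :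
    (Set.range fun k => runPattern s n (2 * k)).ncard = factorComplexity s ((n + 1) / 2) := by
  rw [factorComplexity_eq]
  refine ncard_range_eq_of_iff fun k l => ?_
  rw [runPattern_eq_iff s n _ _ (by omega), factorAt_eq_iff]
  constructor
  · intro h t ht
    have := h (2 * t) (by omega)
    rwa [show (2 * k + 2 * t) / 2 = k + t by omega,
      show (2 * l + 2 * t) / 2 = l + t by omega] at this
  · intro h t ht
    rw [show (2 * k + t) / 2 = k + t / 2 by omega, show (2 * l + t) / 2 = l + t / 2 by omega]
    exact h _ (by omega)

/-- The `n` points from an odd place on are governed by a factor of length `⌊n / 2⌋ + 1`. -/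
theorem ncard_range_runPattern_odd (s : ℕ → Bool) (hn : 0 < n) :
    (Set.range fun k => runPattern s n (2 * k + 1)).ncard = factorComplexity s (n / 2 + 1) := by
  rw [factorComplexity_eq]
  refine ncard_range_eq_of_iff fun k l => ?_
  rw [runPattern_eq_iff s n _ _ (by omega), factorAt_eq_iff]
  constructor
  · intro h t ht
    rcases t with _ | t
    · have := h 0 hn
      rwa [show (2 * k + 1 + 0) / 2 = k by omega, show (2 * l + 1 + 0) / 2 = l by omega] at this
    · have := h (2 * t + 1) (by omega)
      rwa [show (2 * k + 1 + (2 * t + 1)) / 2 = k + (t + 1) by omega,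
        show (2 * l + 1 + (2 * t + 1)) / 2 = l + (t + 1) by omega] at this
  · intro h t ht
    rw [show (2 * k + 1 + t) / 2 = k + (t + 1) / 2 by omega,
      show (2 * l + 1 + t) / 2 = l + (t + 1) / 2 by omega]
    exact h _ (by omega)

theorem setOf_isBoxIndecomposable_eq (s : ℕ → Bool) (hn : 0 < n) :
    {π | π ∈ {π | π ∈ pinClass (pinOfBinary s) ∧ π.IsBoxIndecomposable} ∧ π.size = n} =
      {π | ∃ i, IsRun s i n π ∧ (n = 2 → s (i / 2) = s ((i + 1) / 2))} := by
  ext π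
  constructor
  · rintro ⟨⟨h1, h2⟩, rfl⟩
    obtain ⟨i, hi⟩ := exists_isRun_of_isBoxIndecomposable h1 h2
    refine ⟨i, hi, fun h => ?_⟩
    rw [h] at hi
    exact hi.side_eq_of_isBoxIndecomposable h2
  · rintro ⟨i, hi, h⟩
    exact ⟨⟨hi.mem_pinClass, hi.isBoxIndecomposable hn h⟩, hi.size_eq⟩

theorem count_isBoxIndecomposable_of_le_two (hs : IsSturmian s) (hn : 0 < n) (hn2 : n ≤ 2) :
    count {π | π ∈ pinClass (pinOfBinary s) ∧ π.IsBoxIndecomposable} n = 2 := by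
  rw [count, setOf_isBoxIndecomposable_eq s hn]
  have : {π | ∃ i, IsRun s i n π ∧ (n = 2 → s (i / 2) = s ((i + 1) / 2))} =
      Set.range fun k => runPattern s n (2 * k) := by
    ext π
    constructor
    · rintro ⟨i, hi, h⟩
      obtain ⟨k, rfl | rfl⟩ := Nat.even_or_odd' i
      · exact ⟨k, hi.runPattern_eq⟩
      · obtain rfl | rfl : n = 1 ∨ n = 2 := by omega
        · exact ⟨k, hi.one_of_odd.runPattern_eq⟩
        · have h1 := h rfl
          rw [show (2 * k + 1) / 2 = k by omega, show (2 * k + 1 + 1) / 2 = k + 1 by omega] at h1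
          exact ⟨k, (hi.two_of_odd h1).runPattern_eq⟩
    · rintro ⟨k, rfl⟩
      exact ⟨2 * k, isRun_runPattern s n _, fun _ => by congr 1; omega⟩
  rw [this, ncard_range_runPattern_even, show (n + 1) / 2 = 1 by omega, hs]

/-- Three points at an odd place give a new pattern only when they are all on one side, and this is
the same side throughout. -/
theorem count_isBoxIndecomposable_three (hs : IsSturmian s) :
    count {π | π ∈ pinClass (pinOfBinary s) ∧ π.IsBoxIndecomposable} 3 = 4 := by
  rw [count, setOf_isBoxIndecomposable_eq s (by omega)]
  obtain ⟨k₀, hk₀, huniq⟩ := hs.exists_unique_square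
  have hodd : ∀ k t, t < 3 → s (k + 1) = s k → s ((2 * k + 1 + t) / 2) = s k := by
    intro k t ht h
    obtain h1 | h1 : (2 * k + 1 + t) / 2 = k ∨ (2 * k + 1 + t) / 2 = k + 1 := by omega
    · rw [h1]
    · rw [h1, h]
  have : {π | ∃ i, IsRun s i 3 π ∧ (3 = 2 → s (i / 2) = s ((i + 1) / 2))} =
      insert (runPattern s 3 (2 * k₀ + 1)) (Set.range fun k => runPattern s 3 (2 * k)) := by
    ext π
    constructor
    · rintro ⟨i, hi, -⟩
      obtain ⟨k, rfl | rfl⟩ := Nat.even_or_odd' i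
      · exact Or.inr ⟨k, hi.runPattern_eq⟩
      · by_cases h : s k = s (k + 1)
        · left
          rw [← hi.runPattern_eq, runPattern_eq_iff s 3 _ _ (by omega)]
          intro t ht
          rw [hodd k t ht h.symm, hodd k₀ t ht hk₀.symm]
          exact huniq k h
        · obtain ⟨l, h0, h1⟩ := hs.exists_swap h
          exact Or.inr ⟨l, (hi.of_odd_of_side_ne h h0 h1).runPattern_eq⟩
    · rintro (rfl | ⟨k, rfl⟩)
      · exact ⟨_, isRun_runPattern s 3 _, fun h => by omega⟩
      · exact ⟨_, isRun_runPattern s 3 _, fun h => by omega⟩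
  have hnew : runPattern s 3 (2 * k₀ + 1) ∉ Set.range fun k => runPattern s 3 (2 * k) := by
    rintro ⟨k, hk⟩
    have h1 : IsRun s (2 * k) 3 (runPattern s 3 (2 * k₀ + 1)) := hk ▸ isRun_runPattern s 3 (2 * k)
    have := h1.parity_eq_of_side_eq (isRun_runPattern s 3 (2 * k₀ + 1)) (by omega) (by
      rw [show (2 * k₀ + 1) / 2 = k₀ by omega, show (2 * k₀ + 1 + 1) / 2 = k₀ + 1 by omega, hk₀])
    omega
  have hcard := ncard_range_runPattern_even s 3
  rw [hs] at hcard
  have hfin : (Set.range fun k => runPattern s 3 (2 * k)).Finite := by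
    apply Set.finite_of_ncard_pos
    omega
  rw [this, Set.ncard_insert_of_notMem hnew hfin, hcard]

theorem count_isBoxIndecomposable_of_four_le (hs : IsSturmian s) (hn : 4 ≤ n) :
    count {π | π ∈ pinClass (pinOfBinary s) ∧ π.IsBoxIndecomposable} n = n + 3 := by
  rw [count, setOf_isBoxIndecomposable_eq s (by omega)]
  have : {π | ∃ i, IsRun s i n π ∧ (n = 2 → s (i / 2) = s ((i + 1) / 2))} =
      (Set.range fun k => runPattern s n (2 * k)) ∪
        Set.range fun k => runPattern s n (2 * k + 1) := by
    ext π
    constructor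
    · rintro ⟨i, hi, -⟩
      obtain ⟨k, rfl | rfl⟩ := Nat.even_or_odd' i
      · exact Or.inl ⟨k, hi.runPattern_eq⟩
      · exact Or.inr ⟨k, hi.runPattern_eq⟩
    · rintro (⟨k, rfl⟩ | ⟨k, rfl⟩)
      · exact ⟨_, isRun_runPattern s n _, fun h => by omega⟩
      · exact ⟨_, isRun_runPattern s n _, fun h => by omega⟩
  have hdisj : Disjoint (Set.range fun k => runPattern s n (2 * k))
      (Set.range fun k => runPattern s n (2 * k + 1)) := by
    rw [Set.disjoint_left]
    rintro _ ⟨k, rfl⟩ ⟨l, hl⟩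
    simp only at hl
    have h1 : IsRun s (2 * l + 1) n (runPattern s n (2 * k)) := hl ▸ isRun_runPattern s n _
    have := (isRun_runPattern s n (2 * k)).parity_eq h1 (by omega) hn
    omega
  have h1 := ncard_range_runPattern_even s n
  have h2 := ncard_range_runPattern_odd s (n := n) (by omega)
  rw [hs] at h1 h2
  rw [this, Set.ncard_union_eq hdisj (Set.finite_of_ncard_pos (by omega))
    (Set.finite_of_ncard_pos (by omega)), h1, h2]
  omega

open PowerSeries in
theorem boxIndecGF_pinClass (hs : IsSturmian s) : boxIndecGF (pinClass (pinOfBinary s)) =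
    (2 * X - 2 * X ^ 2 + 2 * X ^ 3 + X ^ 4 - 2 * X ^ 5) * ((1 - X) ^ 2)⁻¹ := by
  have hc : constantCoeff ((1 - X : PowerSeries ℚ) ^ 2) ≠ 0 := by simp
  rw [PowerSeries.eq_mul_inv_iff_mul_eq hc, boxIndecGF]
  obtain ⟨g, hg⟩ : ∃ g : ℕ → ℚ, g = fun n => (count
    {π | π ∈ pinClass (pinOfBinary s) ∧ π.IsBoxIndecomposable} n : ℚ) := ⟨_, rfl⟩
  have g0 : g 0 = 0 := by rw [hg]; simp [count_isBoxIndecomposable_zero]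
  have g1 : g 1 = 2 := by
    rw [hg]; simp [count_isBoxIndecomposable_of_le_two hs (n := 1) (by omega) (by omega)]
  have g2 : g 2 = 2 := by
    rw [hg]; simp [count_isBoxIndecomposable_of_le_two hs (n := 2) (by omega) (by omega)]
  have g3 : g 3 = 4 := by rw [hg]; simp [count_isBoxIndecomposable_three hs]
  have g4 : ∀ n, g (n + 4) = n + 7 := fun n => by
    rw [hg]
    simp only [count_isBoxIndecomposable_of_four_le hs (n := n + 4) (by omega)]
    push_cast
    ring
  rw [← hg]
  have key : PowerSeries.mk g * (1 - X) ^ 2 =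
      PowerSeries.mk g - C 2 * (PowerSeries.mk g * X ^ 1) + PowerSeries.mk g * X ^ 2 := by
    simp only [map_ofNat]
    ring
  have key' : (2 * X - 2 * X ^ 2 + 2 * X ^ 3 + X ^ 4 - 2 * X ^ 5 : PowerSeries ℚ) =
      C 2 * X ^ 1 - C 2 * X ^ 2 + C 2 * X ^ 3 + X ^ 4 - C 2 * X ^ 5 := by
    simp only [map_ofNat]
    ring
  rw [key, key']
  ext n
  simp only [map_add, map_sub, coeff_C_mul, coeff_mul_X_pow', coeff_X_pow, coeff_mk]
  obtain rfl | rfl | rfl | rfl | rfl | rfl | ⟨m, rfl⟩ :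
      n = 0 ∨ n = 1 ∨ n = 2 ∨ n = 3 ∨ n = 4 ∨ n = 5 ∨ ∃ m, n = m + 6 := by
    by_cases h : 6 ≤ n
    · obtain ⟨m, rfl⟩ := Nat.exists_eq_add_of_le' h
      exact Or.inr (Or.inr (Or.inr (Or.inr (Or.inr (Or.inr ⟨m, rfl⟩)))))
    · omega
  · simp [g0]
  · simp [g0, g1]
  · simp [g0, g1, g2]; norm_num
  · simp [g1, g2, g3]; norm_num
  · have := g4 0
    simp at this
    simp [g2, g3, this]; norm_num
  · have h4 := g4 0
    have h5 := g4 1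
    simp at h4 h5
    simp [g3, h4, h5]; norm_num
  · have h4 := g4 m
    have h5 := g4 (m + 1)
    have h6 := g4 (m + 2)
    rw [show m + 1 + 4 = m + 5 by ring] at h5
    rw [show m + 2 + 4 = m + 6 by ring] at h6
    simp [h4, h5, h6]
    ring

/-! ### The growth rate, and uncountability -/

theorem hasGrowthRate_pinClass {s : ℕ → Bool} (hs : IsSturmian s) {μ : ℝ} (hlo : 3.28 < μ)
    (hhi : μ < 3.29) (hμ : μ ^ 5 - 4 * μ ^ 4 + 3 * μ ^ 3 - 2 * μ ^ 2 - μ + 2 = 0) :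
    HasGrowthRate (pinClass (pinOfBinary s)) μ := by
  have hbox := isBoxClosed_pinClass hs
  have hzero := count_zero (empty_mem_pinClass (pinOfBinary s))
  have hsum : ∀ n, 2 * count (pinClass (pinOfBinary s)) n ≤
      count (pinClass (pinOfBinary s)) (n + 1) := by
    intro n
    rw [count_eq_sum_antidiagonal hbox mem_pinClass_of_boxSum_mem snd_point_pos_of_mem
      n.succ_pos, ← count_isBoxIndecomposable_of_le_two hs (n := 1) (by omega) (by omega)]
    exact Finset.single_le_sum (f := fun p : ℕ × ℕ => count
      {π | π ∈ pinClass (pinOfBinary s) ∧ π.IsBoxIndecomposable} p.1 *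
        count (pinClass (pinOfBinary s)) p.2) (fun p _ => Nat.zero_le _)
      (Finset.HasAntidiagonal.mem_antidiagonal.2 (show (1, n).1 + (1, n).2 = n + 1 by
        simp only; omega))
  have hpos : ∀ n, 0 < count (pinClass (pinOfBinary s)) n := by
    intro n
    induction n with
    | zero => rw [hzero]; exact one_pos
    | succ n ih => have := hsum n; omega
  have hrec := recurrence_of_mul_one_sub (mk_count_mul_one_sub_boxIndecGF hbox
    mem_pinClass_of_boxSum_mem snd_point_pos_of_mem (empty_mem_pinClass _))
    (boxIndecGF_pinClass hs)
  refine tendsto_root_of_recurrence (a := fun n => (count (pinClass (pinOfBinary s)) n : ℝ))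
    hlo hhi hμ (fun n => by exact_mod_cast hpos n) (fun n => by exact_mod_cast hsum n) fun n => ?_
  exact_mod_cast hrec n

/-- Box indecomposables of even size at least four show the factors of the word, so equal classes
come from words with the same long factors. -/
theorem exists_common_factor {s s' : ℕ → Bool}
    (h : pinClass (pinOfBinary s) = pinClass (pinOfBinary s')) {n : ℕ} (hn : 2 ≤ n) :
    ∃ k k', ∀ i < n, s (k + i) = s' (k' + i) := by
  have hr := isRun_runPattern s (2 * n) 0
  have hi := hr.isBoxIndecomposable (by omega) (by omega)
  obtain ⟨j, hj⟩ := exists_isRun_of_isBoxIndecomposable (h ▸ hr.mem_pinClass) hi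
  rw [hr.size_eq] at hj
  have hpar := hr.parity_eq hj rfl (by omega)
  have hside := hr.side_eq hj (by omega)
  refine ⟨0, j / 2, fun i hi => ?_⟩
  have := hside (2 * i) (by omega)
  rwa [show (0 + 2 * i) / 2 = 0 + i by omega, show (j + 2 * i) / 2 = j / 2 + i by omega] at this

theorem not_countable_pinClass_of_isSturmian :
    ¬ {C : Set GriddedPerm | ∃ s : ℕ → Bool, IsSturmian s ∧
      C = pinClass (pinOfBinary s)}.Countable := by
  intro h
  refine not_countable_irrational_Ioo
    (Set.MapsTo.countable_of_injOn (f := fun α => pinClass (pinOfBinary (mechanicalWord α)))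
      (t := {C | ∃ s : ℕ → Bool, IsSturmian s ∧ C = pinClass (pinOfBinary s)}) ?_ ?_ h)
  · rintro α ⟨hα, h0, h1⟩
    exact ⟨_, isSturmian_mechanicalWord h0 h1 hα, rfl⟩
  · rintro α ⟨-, h0, h1⟩ β ⟨-, h0', h1'⟩ he
    exact slope_eq_of_common_factors h0 h1 h0' h1' fun n hn => exists_common_factor he hn

end GriddedPerm

open GriddedPerm in
theorem theorem5p2 :
    ∃ μ : ℝ,
      IsGreatest {x : ℝ | x ^ 5 - 4 * x ^ 4 + 3 * x ^ 3 - 2 * x ^ 2 - x + 2 = 0} μ ∧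
      |μ - 3.28277| < 1 / 100000 ∧
      -- uncountably many pin sequences have a pin class of growth rate `μ`
      ¬ {w : ℕ → PinLetter | IsPinSeq w ∧ HasGrowthRate (pinClass w) μ}.Countable ∧
      -- even the sequences `φ(s)` for Sturmian `s` give uncountably many distinct classes
      ¬ {C : Set GriddedPerm | ∃ s : ℕ → Bool, IsSturmian s ∧ C = pinClass (pinOfBinary s)}.Countable ∧
      ∀ s : ℕ → Bool, IsSturmian s →
        IsPinSeq (pinOfBinary s) ∧
        HasGrowthRate (pinClass (pinOfBinary s)) μ ∧
        IsBoxClosed (pinClass (pinOfBinary s)) ∧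
        boxIndecGF (pinClass (pinOfBinary s)) =
          (2 * PowerSeries.X - 2 * PowerSeries.X ^ 2 + 2 * PowerSeries.X ^ 3 + PowerSeries.X ^ 4
            - 2 * PowerSeries.X ^ 5) * ((1 - PowerSeries.X) ^ 2)⁻¹ := by
  obtain ⟨μ, hμ, hlo, hhi⟩ := exists_isGreatest_quintic_root
  have hgrowth : ∀ s : ℕ → Bool, IsSturmian s → HasGrowthRate (pinClass (pinOfBinary s)) μ :=
    fun s hs => hasGrowthRate_pinClass hs (by linarith) (by linarith) hμ.1
  refine ⟨μ, hμ, by rw [abs_lt]; constructor <;> linarith, fun hcount => ?_,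
    not_countable_pinClass_of_isSturmian, fun s hs =>
      ⟨isPinSeq_pinOfBinary s, hgrowth s hs, isBoxClosed_pinClass hs, boxIndecGF_pinClass hs⟩⟩
  refine not_countable_pinClass_of_isSturmian ((hcount.image pinClass).mono ?_)
  rintro _ ⟨s, hs, rfl⟩
  exact ⟨_, ⟨isPinSeq_pinOfBinary s, hgrowth s hs⟩, rfl⟩
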